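/- Let $d\ge 1$, let $I_\pm=\{\pm1,\dots,\pm d\}$ label the canonical basis $|\tau\rangle$ of $\mathbb C^{2d}$, and let $r:I_\pm\to\mathbb Z^d$ be any function, with mean $\overline r=\frac1{2d}\sum_{\tau}r(\tau)$. On $\mathbb C^{2d}\otimes\ell^2(\mathbb Z^d)$ let $S=\sum_{x\in\mathbb Z^d}\sum_{\tau\in I_\pm}|\tau\rangle\langle\tau|\otimes|x+r(\tau)\rangle\langle x|$. Let $C(\omega)$ be a random unitary $2d\times 2d$ matrix on a probability space $(\Omega,\mu)$, and let $\overline\omega=(\omega_1,\omega_2,\dots)$ be distributed according to the product measure $\mu^{\otimes\mathbb N^*}$, with expectation $\mathbb E$. Set $U_{\overline\omega}(n,0)=U_n\cdots U_1$, $U_k=S(C(\omega_k)\otimes\mathbb I)$. Let $\rho_0$ be a density matrix on $\mathbb C^{2d}\otimes\ell^2(\mathbb Z^d)$ (a non-negative operator of trace one) with kernel $\rho_0(x,y)\in M_{2d}(\mathbb C)$, $\rho_0(x,y)_{\sigma\tau}=\langle\sigma\otimes x|\rho_0|\tau\otimes y\rangle$, such that $\sum_{x,y\in\mathbb Z^d}\|\rho_0(x,y)\|<\infty$.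 Let $\rho_n^{\overline\omega}=U_{\overline\omega}(n,0)\rho_0U_{\overline\omega}(n,0)^*$, and define the averaged position distribution and its characteristic function by $$w_z(n)=\mathbb E\big(\mathrm{Tr}\,\rho^{\overline\omega}_n(z,z)\big),\qquad \Phi_n^{\rho_0}(y)=\sum_{z\in\mathbb Z^d}w_z(n)e^{iyz}\quad(y\in\mathbb R^d).$$ For $y,y'\in\mathbb R^d$ put $D(y,y')=\sum_{\tau,\tau'}e^{i(yr(\tau)+y'r(\tau'))}|\tau\otimes\tau'\rangle\langle\tau\otimes\tau'|$ and $\mathcal M(y,y')=D(y,y')\,\mathbb E\big(C(\omega)\otimes\overline{C(\omega)}\big)$ on $\mathbb C^{2d}\otimes\mathbb C^{2d}$; $\Psi_1=\sum_\tau|\tau\otimes\tau\rangle$, $P=\frac1{2d}|\Psi_1\rangle\langle\Psi_1|$; and $$R_0(y,y')=\sum_{k,k'\in\mathbb Z^d}e^{i(yk+y'k')}\rho_0(k,k'),\qquad \mathbf R_0(y,y')=\sum_{\tau,\tau'}\langle\tau|R_0(y,y')\tau'\rangle\,|\tau\otimes\tau'\rangle .$$ Assumption S: for all $v\in[0,2\pi)^d$,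 $1$ is the only point of the spectrum of $\mathcal M(-v,v)$ on the unit circle, and it is a simple eigenvalue. Under Assumption S the following hold. (a) For every $v\in\mathbb R^d$ the limit $S_v(1)=\lim_{z\to1}\Big((\mathcal M(-v,v)-z)^{-1}-\frac{P}{1-z}\Big)$ exists. Let $\mathbb D(v)$ be the symmetric $d\times d$ matrix with $$\langle y|\mathbb D(v)y\rangle=-\frac1d\Big(\sum_{\tau}\frac{(yr(\tau))^2}{2}+\sum_{\tau,\tau'}(yr(\tau))(yr(\tau'))\Big\{\langle\tau\otimes\tau|S_v(1)\,\tau'\otimes\tau'\rangle-\frac1{2d}\Big\}\Big)-(y\overline r)^2 .$$ (b) For every $v\in\mathbb R^d$, $R_0(-v,v)=\sum_{k,l\in\mathbb Z^d}e^{ivl}\rho_0(k,k+l)$. (c) For every $t\ge0$ and $y\in\mathbb R^d$, $$\lim_{n\to\infty}\Phi^{\rho_0}_{[tn]}(y/n)=e^{ity\overline r},$$ $$\lim_{n\to\infty}e^{-i[tn]\frac{\overline ry}{\sqrt n}}\Phi^{\rho_0}_{[tn]}(y/\sqrt n)=\int_{\mathbb T^d}e^{-\frac t2\langle y|\mathbb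 D(v)y\rangle}\langle\Psi_1|\mathbf R_0(-v,v)\rangle\,d\tilde v=\int_{\mathbb T^d}e^{-\frac t2\langle y|\mathbb D(v)y\rangle}\,\mathrm{Tr}\,R_0(-v,v)\,d\tilde v,$$ where $\mathbb T^d=[0,2\pi)^d$, $d\tilde v=dv/(2\pi)^d$, and the integrands are integrable. -/

import Mathlib

open MeasureTheory Filter Topology Complex
open scoped Matrix Kronecker

namespace QuantumWalk

noncomputable section

/-! ### The Hilbert space of the walker -/

/-- The set `I_± = {±1, …, ±d}` of the `2d` coin labels, the two labels attached to the direction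
`j` being `(j, true)` for `+j` and `(j, false)` for `-j`. -/
abbrev Coin (d : ℕ) : Type := Fin d × Bool

/-- The lattice `ℤ^d`. -/
abbrev Lattice (d : ℕ) : Type := Fin d → ℤ

/-- The internal space `ℂ^{2d}` with its canonical orthonormal basis indexed by `I_±`. -/
abbrev CoinSpace (d : ℕ) : Type := EuclideanSpace ℂ (Coin d)

/-- The Hilbert space `ℂ^{2d} ⊗ ℓ²(ℤ^d)`, realised as `ℓ²(ℤ^d; ℂ^{2d})`:
a vector `ψ` is the family `(ψ(x))_x` with `∑ ‖ψ(x)‖² < ∞`. -/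
abbrev WalkSpace (d : ℕ) : Type := lp (fun _ : Lattice d => CoinSpace d) 2

/-- Complex square matrices indexed by `I_±`. -/
abbrev CoinMatrix (d : ℕ) : Type := Matrix (Coin d) (Coin d) ℂ

/-- Matrices on `ℂ^{2d} ⊗ ℂ^{2d}` in the canonical basis `|τ ⊗ τ'⟩`. -/
abbrev PairMatrix (d : ℕ) : Type := Matrix (Coin d × Coin d) (Coin d × Coin d) ℂ

/-- The basis vector `|τ⟩ ⊗ |x⟩`. -/
def ket {d : ℕ} (τ : Coin d) (x : Lattice d) : WalkSpace d :=
  lp.single 2 x (EuclideanSpace.single τ (1 : ℂ))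

theorem memlp_tensorId {d : ℕ} (A : CoinSpace d →L[ℂ] CoinSpace d) (ψ : WalkSpace d) :
    Memℓp (fun x => A (ψ x)) 2 :=
  Memℓp.mono (((lp.memℓp ψ).norm).const_mul ‖A‖) fun x => A.le_opNorm (ψ x)

/-- The operator `A ⊗ 𝕀`, acting by `(A ⊗ 𝕀) ψ (x) = A (ψ(x))`. -/
def tensorId {d : ℕ} (A : CoinSpace d →L[ℂ] CoinSpace d) : WalkSpace d →L[ℂ] WalkSpace d :=
  LinearMap.mkContinuous
    { toFun := fun ψ => ⟨fun x => A (ψ x), memlp_tensorId A ψ⟩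
      map_add' := fun ψ φ => by ext x : 2; exact map_add A (ψ x) (φ x)
      map_smul' := fun c ψ => by ext x : 2; exact map_smul A c (ψ x) }
    ‖A‖ (fun ψ => by
      have h : ‖((⟨fun x => A (ψ x), memlp_tensorId A ψ⟩ : WalkSpace d))‖
          ≤ ‖(‖A‖ : ℂ) • ψ‖ := by
        refine lp.norm_mono (by norm_num) fun x => ?_
        have h2 := A.le_opNorm (ψ x)
        rw [lp.coeFn_smul, Pi.smul_apply, norm_smul]
        simpa using h2
      refine h.trans (le_of_eq ?_)
      rw [norm_smul]
      simp)

theorem memlp_translation {d : ℕ} (k : Lattice d) (ψ : WalkSpace d) :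
    Memℓp (fun x => ψ (x - k)) 2 := by
  refine memℓp_gen ?_
  exact ((Equiv.subRight k).summable_iff
    (f := fun x => ‖ψ x‖ ^ (2 : ENNReal).toReal)).2 ((lp.memℓp ψ).summable (by norm_num))

/-- The operator `𝕀 ⊗ ∑ₓ |x + k⟩⟨x|`, acting by `(T_k ψ)(x) = ψ(x - k)`. -/
def translation {d : ℕ} (k : Lattice d) : WalkSpace d →L[ℂ] WalkSpace d :=
  LinearMap.mkContinuous
    { toFun := fun ψ => ⟨fun x => ψ (x - k), memlp_translation k ψ⟩
      map_add' := fun ψ φ => by ext x : 2; rfl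
      map_smul' := fun c ψ => by ext x : 2; rfl }
    1 (fun ψ => by
      rw [one_mul]
      refine le_of_eq ?_
      rw [lp.norm_eq_tsum_rpow (by norm_num), lp.norm_eq_tsum_rpow (by norm_num)]
      congr 1
      exact (Equiv.subRight k).tsum_eq (fun x => ‖ψ x‖ ^ (2 : ENNReal).toReal))

/-! ### The dynamics -/

/-- The operator on `ℂ^{2d}` with the given matrix in the canonical basis. -/
def coinOp {d : ℕ} (C : CoinMatrix d) : CoinSpace d →L[ℂ] CoinSpace d :=
  Matrix.toEuclideanCLM (𝕜 := ℂ) C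

/-- The shift `S = ∑_τ ∑ₓ P_τ ⊗ |x + r(τ)⟩⟨x|` of the jump function `r`, `P_τ = |τ⟩⟨τ|`. -/
def shift {d : ℕ} (r : Coin d → Lattice d) : WalkSpace d →L[ℂ] WalkSpace d :=
  ∑ τ : Coin d, tensorId (coinOp (Matrix.single τ τ 1)) ∘L translation (r τ)

/-- `U(n,0) = U_n ⋯ U_1` with `U_k = S (C_k ⊗ 𝕀)`; the coin matrix `C_k` of step `k ≥ 1` is
`C (k - 1)`. -/
def evolution {d : ℕ} (r : Coin d → Lattice d) (C : ℕ → CoinMatrix d) :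
    ℕ → (WalkSpace d →L[ℂ] WalkSpace d)
  | 0 => ContinuousLinearMap.id ℂ (WalkSpace d)
  | n + 1 => (shift r ∘L tensorId (coinOp (C n))) ∘L evolution r C n

/-- The density matrix `ρ_n = U(n,0) ρ₀ U(n,0)*` at time `n`. -/
def evolved {d : ℕ} (r : Coin d → Lattice d) (C : ℕ → CoinMatrix d)
    (ρ₀ : WalkSpace d →L[ℂ] WalkSpace d) (n : ℕ) : WalkSpace d →L[ℂ] WalkSpace d :=
  evolution r C n ∘L ρ₀ ∘L (evolution r C n).adjoint

/-- The kernel `ρ(x,y) ∈ M_{2d}(ℂ)`, `ρ_{στ}(x,y) = ⟨σ ⊗ x | ρ | τ ⊗ y⟩`. -/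
def kernel {d : ℕ} (ρ : WalkSpace d →L[ℂ] WalkSpace d) (x y : Lattice d) : CoinMatrix d :=
  Matrix.of fun σ τ => inner ℂ (ket σ x) (ρ (ket τ y))

/-- A density matrix: a non-negative trace class operator of trace one. (A non-negative operator is
trace class as soon as its diagonal is summable in one orthonormal basis.) -/
structure IsDensityMatrix {d : ℕ} (ρ : WalkSpace d →L[ℂ] WalkSpace d) : Prop where
  isPositive : ρ.IsPositive
  hasTrace_one : HasSum (fun x : Lattice d => (kernel ρ x x).trace) 1

/-- `W_z(n) = P(X_n = z) = Tr ρ_n(z,z)`. -/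
def positionProb {d : ℕ} (r : Coin d → Lattice d) (C : ℕ → CoinMatrix d)
    (ρ₀ : WalkSpace d →L[ℂ] WalkSpace d) (n : ℕ) (z : Lattice d) : ℂ :=
  (kernel (evolved r C ρ₀ n) z z).trace

/-! ### The random walk: i.i.d. coins `C(ω₁), C(ω₂), …` -/

/-- The averaged distribution `w_z(n) = 𝔼 (W_z^ω̄(n))`, the expectation being with respect to the
product measure `⨂_k μ` on sequences `ω̄` in `Ω`. -/
def averagedProb {d : ℕ} {Ω : Type*} [MeasurableSpace Ω] (μ : Measure Ω) (C : Ω → CoinMatrix d)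
    (r : Coin d → Lattice d) (ρ₀ : WalkSpace d →L[ℂ] WalkSpace d) (n : ℕ) (z : Lattice d) : ℂ :=
  ∫ ω : ℕ → Ω, positionProb r (fun k => C (ω k)) ρ₀ n z ∂(Measure.infinitePi fun _ : ℕ => μ)

/-- The phase `e^{iyk}`, `yk = ∑_j y_j k_j`. -/
def phase {d : ℕ} (y : Fin d → ℝ) (k : Lattice d) : ℂ :=
  Complex.exp (I * ((∑ j, y j * (k j : ℝ) : ℝ) : ℂ))

/-- The averaged characteristic function `Φ_n^{ρ₀}(y) = ∑_z w_z(n) e^{iyz}`. -/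
def charFn {d : ℕ} {Ω : Type*} [MeasurableSpace Ω] (μ : Measure Ω) (C : Ω → CoinMatrix d)
    (r : Coin d → Lattice d) (ρ₀ : WalkSpace d →L[ℂ] WalkSpace d) (n : ℕ) (y : Fin d → ℝ) : ℂ :=
  ∑' z : Lattice d, averagedProb μ C r ρ₀ n z * phase y z

/-! ### The averaged transfer matrices -/

/-- `ℰ = 𝔼 (C(ω) ⊗ C̄(ω))`, the expectation being taken entrywise. -/
def meanCoin {d : ℕ} {Ω : Type*} [MeasurableSpace Ω] (μ : Measure Ω) (C : Ω → CoinMatrix d) :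
    PairMatrix d :=
  Matrix.of fun S T => ∫ ω, (C ω ⊗ₖ (C ω).map star) S T ∂μ

/-- `D(y,y') = ∑_{τ,τ'} e^{i(y r(τ) + y' r(τ'))} |τ ⊗ τ'⟩⟨τ ⊗ τ'|`. -/
def phaseMatrix {d : ℕ} (r : Coin d → Lattice d) (y y' : Fin d → ℝ) : PairMatrix d :=
  Matrix.diagonal fun T => phase y (r T.1) * phase y' (r T.2)

/-- `ℳ(y,y') = D(y,y') ℰ`. -/
def meanTransfer {d : ℕ} {Ω : Type*} [MeasurableSpace Ω] (μ : Measure Ω) (C : Ω → CoinMatrix d)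
    (r : Coin d → Lattice d) (y y' : Fin d → ℝ) : PairMatrix d :=
  phaseMatrix r y y' * meanCoin μ C

/-- The fundamental box `[0, 2π)^d` representing the torus `𝕋^d`. -/
def torusBox (d : ℕ) : Set (Fin d → ℝ) := Set.univ.pi fun _ => Set.Ico 0 (2 * Real.pi)

/-- Assumption S: for all `v ∈ [0,2π)^d`, `1` is the only point of the spectrum of `ℳ(-v,v)` on the
unit circle, and it is a simple eigenvalue. -/
def AssumptionS {d : ℕ} {Ω : Type*} [MeasurableSpace Ω] (μ : Measure Ω) (C : Ω → CoinMatrix d)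
    (r : Coin d → Lattice d) : Prop :=
  ∀ v ∈ torusBox d,
    spectrum ℂ (meanTransfer μ C r (-v) v) ∩ Metric.sphere 0 1 = {1} ∧
      (meanTransfer μ C r (-v) v).charpoly.rootMultiplicity 1 = 1

/-- `Ψ₁ = ∑_τ |τ ⊗ τ⟩`. -/
def psiOne (d : ℕ) : Coin d × Coin d → ℂ := fun T => if T.1 = T.2 then 1 else 0

/-- The orthogonal projector `P = |Ψ₀⟩⟨Ψ₀|`, `Ψ₀ = Ψ₁ / ‖Ψ₁‖`, where `‖Ψ₁‖² = 2d`. -/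
def projPsi (d : ℕ) : PairMatrix d :=
  (2 * d : ℂ)⁻¹ • Matrix.vecMulVec (psiOne d) (star (psiOne d))

/-- `S_v(z)` for `z ≠ 1`: `(ℳ(-v,v) - z)⁻¹ = P / (1 - z) + S_v(z)`. -/
def reducedResolvent {d : ℕ} {Ω : Type*} [MeasurableSpace Ω] (μ : Measure Ω)
    (C : Ω → CoinMatrix d) (r : Coin d → Lattice d) (v : Fin d → ℝ) (z : ℂ) : PairMatrix d :=
  (meanTransfer μ C r (-v) v - z • (1 : PairMatrix d))⁻¹ - (1 - z)⁻¹ • projPsi d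

/-- `S_v(1)`, the value at `z = 1` of the continuous extension of `S_v`. -/
def reducedResolventOne {d : ℕ} {Ω : Type*} [MeasurableSpace Ω] (μ : Measure Ω)
    (C : Ω → CoinMatrix d) (r : Coin d → Lattice d) (v : Fin d → ℝ) : PairMatrix d :=
  limUnder (𝓝[≠] (1 : ℂ)) (reducedResolvent μ C r v)

/-- The mean jump `r̄ = (1/2d) ∑_τ r(τ)`. -/
def meanJump {d : ℕ} (r : Coin d → Lattice d) (j : Fin d) : ℝ :=
  (2 * d : ℝ)⁻¹ * ∑ τ : Coin d, (r τ j : ℝ)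

/-- `y r̄ = ∑_j y_j r̄_j`. -/
def drift {d : ℕ} (r : Coin d → Lattice d) (y : Fin d → ℝ) : ℝ := ∑ j, y j * meanJump r j

/-- The symmetric matrix `A(v)` of the second order term `-½ ⟨y, A(v) y⟩` in the expansion at
`y = 0` of the eigenvalue of `ℳ(y-v,v)` close to `1`:
`-½ ⟨y, A(v) y⟩ = (1/2d) (∑_τ (y r(τ))²/2`
`  + ∑_{τ,τ'} (y r(τ)) (y r(τ')) {⟨τ⊗τ| S_v(1) |τ'⊗τ'⟩ - 1/(2d)})`. -/
def secondOrderMatrix {d : ℕ} {Ω : Type*} [MeasurableSpace Ω] (μ : Measure Ω)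
    (C : Ω → CoinMatrix d) (r : Coin d → Lattice d) (v : Fin d → ℝ) : Matrix (Fin d) (Fin d) ℂ :=
  Matrix.of fun j k =>
    -(d : ℂ)⁻¹ * ((∑ τ : Coin d, (r τ j : ℂ) * (r τ k : ℂ) / 2) +
      ∑ τ : Coin d, ∑ τ' : Coin d,
        ((r τ j : ℂ) * (r τ' k : ℂ) + (r τ k : ℂ) * (r τ' j : ℂ)) / 2 *
          (reducedResolventOne μ C r v (τ, τ) (τ', τ') - (2 * d : ℂ)⁻¹))

/-- The diffusion matrix `𝔻(v)`, i.e. `𝔻(v) = A(v) - |r̄⟩⟨r̄|`. The last term comes from the centring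
factor `e^{-i[tn] r̄ y/√n}`: minus one half of `⟨y, 𝔻(v) y⟩` is the second order term of the logarithm
of the eigenvalue `1 + i y r̄ - ½ ⟨y, A(v) y⟩ + O(‖y‖³)`. -/
def diffusionMatrix {d : ℕ} {Ω : Type*} [MeasurableSpace Ω] (μ : Measure Ω)
    (C : Ω → CoinMatrix d) (r : Coin d → Lattice d) (v : Fin d → ℝ) : Matrix (Fin d) (Fin d) ℂ :=
  secondOrderMatrix μ C r v - Matrix.of fun j k => ((meanJump r j * meanJump r k : ℝ) : ℂ)

/-- The quadratic form `⟨y, 𝔻(v) y⟩`. -/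
def diffusionForm {d : ℕ} {Ω : Type*} [MeasurableSpace Ω] (μ : Measure Ω)
    (C : Ω → CoinMatrix d) (r : Coin d → Lattice d) (v y : Fin d → ℝ) : ℂ :=
  (fun j => (y j : ℂ)) ⬝ᵥ (diffusionMatrix μ C r v *ᵥ fun j => (y j : ℂ))

/-! ### The Fourier transform of the initial density matrix -/

/-- `R₀(y,y') = ∑_{k,k'} e^{i(yk + y'k')} ρ₀(k,k') ∈ M_{2d}(ℂ)`. -/
def fourierKernel {d : ℕ} (ρ₀ : WalkSpace d →L[ℂ] WalkSpace d) (y y' : Fin d → ℝ) :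
    CoinMatrix d :=
  ∑' p : Lattice d × Lattice d, (phase y p.1 * phase y' p.2) • kernel ρ₀ p.1 p.2

/-- The vector `𝐑₀(y,y') = ∑_{τ,τ'} ⟨τ|R₀(y,y') τ'⟩ |τ ⊗ τ'⟩`. -/
def fourierVec {d : ℕ} (ρ₀ : WalkSpace d →L[ℂ] WalkSpace d) (y y' : Fin d → ℝ) :
    Coin d × Coin d → ℂ :=
  fun T => fourierKernel ρ₀ y y' T.1 T.2

/-- The integral over `𝕋^d` with respect to the normalized measure `dṽ = dv / (2π)^d`. -/
def torusIntegral {d : ℕ} (f : (Fin d → ℝ) → ℂ) : ℂ :=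
  ((2 * Real.pi : ℝ) ^ d : ℂ)⁻¹ * ∫ v in torusBox d, f v

end

end QuantumWalk

/-!
In Fourier space the averaged walk is linear: the transform of the averaged kernel `𝔼 ρ_n` at
`(y - v, v)` is multiplied by `ℳ(y - v, v)` at each step, and integrating over `v ∈ 𝕋^d` selects the
diagonal `k = k'`. Hence `Φ_N(y)` is the torus average of `⟨Ψ₁| ℳ(y - v, v)^N R₀(y - v, v)⟩`.

Put `y ↦ ε y` and remove the drift phase. Then `ℳ(ε y - v, v)` becomes `exp(iε G) M`, where
`M = ℳ(-v, v)` is a contraction whose simple eigenvalue `1` has left and right eigenvector `Ψ₁`, and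
`G` is the centred jump, so that `P G P = 0`. Second order perturbation theory provides
`X = P + O(ε)` with `X exp(iε G) M = exp(-ε² ⟨y|𝔻(v)y⟩ / 2) X + o(ε²)`. Since all the factors are
contractions, the errors only add up over `N ~ κ / ε²` steps, to `o(1)`, and
`P (exp(iε G) M)^N` tends to `exp(-κ ⟨y|𝔻(v)y⟩ / 2) P`. Dominated convergence in `v` gives the
limit of `Φ_N`: the ballistic scaling is `ε = 1 / n`, `κ = 0`, the diffusive one is `ε = 1 / √n`,
`κ = t`.
-/

namespace QuantumWalk

noncomputable section

theorem mul_reduced_inverse_mul {𝔸 : Type*} [Ring 𝔸] {R M P S : 𝔸}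
    (hS : S * (M - 1) = 1 - P) (hR : R * P = 0) :
    R * S * M = R * S + R := by
  have h : R * S * (M - 1) = R := by rw [mul_assoc, hS, mul_sub, mul_one, hR, sub_zero]
  rwa [mul_sub, mul_one, sub_eq_iff_eq_add'] at h

section Perturbation

variable {𝔸 : Type*} [NormedRing 𝔸]

theorem norm_mul_pow_le (X : 𝔸) {T : 𝔸} (hT : ‖T‖ ≤ 1) (k : ℕ) : ‖X * T ^ k‖ ≤ ‖X‖ := by
  induction k with
  | zero => simp
  | succ k ih =>
    rw [pow_succ, ← mul_assoc]
    exact (norm_mul_le_of_le ih hT).trans_eq (mul_one _)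

variable [NormedAlgebra ℂ 𝔸]

theorem norm_mul_pow_sub_smul_le {X T : 𝔸} {m : ℂ} {K q : ℝ} (hT : ‖T‖ ≤ 1) (hK : 1 ≤ K)
    (hm : ‖m‖ ≤ K) (hX : ‖X * T - m • X‖ ≤ q) (k : ℕ) :
    ‖X * T ^ k - m ^ k • X‖ ≤ k * (K ^ k * q) := by
  have hq : 0 ≤ q := (norm_nonneg _).trans hX
  induction k with
  | zero => simp
  | succ k ih =>
    have telescope : X * T ^ (k + 1) - m ^ (k + 1) • X =
        (X * T ^ k - m ^ k • X) * T + m ^ k • (X * T - m • X) := by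
      rw [pow_succ T, pow_succ m, sub_mul, smul_sub, smul_mul_assoc, smul_smul, mul_assoc]
      abel
    calc ‖X * T ^ (k + 1) - m ^ (k + 1) • X‖
        ≤ ‖X * T ^ k - m ^ k • X‖ * ‖T‖ + ‖m‖ ^ k * ‖X * T - m • X‖ := by
          rw [telescope]
          exact norm_add_le_of_le (norm_mul_le _ _) (by rw [norm_smul, norm_pow])
      _ ≤ k * (K ^ k * q) * 1 + K ^ k * q := by gcongr
      _ = (k + 1) * (K ^ k * q) := by ring
      _ ≤ (k + 1) * (K ^ (k + 1) * q) := by gcongr; exacts [Nat.le_succ k]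
      _ = _ := by push_cast; ring

theorem tendsto_mul_pow_of_approx_eigenvector {ι : Type*} {l : Filter ι} {X T : ι → 𝔸} {X₀ : 𝔸}
    {N : ι → ℕ} {ε : ι → ℂ} {c κ : ℂ} (hT : ∀ a, ‖T a‖ ≤ 1) (hX : Tendsto X l (𝓝 X₀))
    (hN : Tendsto (fun a => N a * ε a) l (𝓝 κ))
    (hXT : (fun a => X a * T a - Complex.exp (ε a * c) • X a) =o[l] ε) :
    Tendsto (fun a => X₀ * T a ^ N a) l (𝓝 (Complex.exp (κ * c) • X₀)) := by
  have hdefect : Tendsto (fun a => N a * ‖X a * T a - Complex.exp (ε a * c) • X a‖) l (𝓝 0) := by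
    have h := (Asymptotics.isBigO_refl (fun a => (N a : ℝ)) l).mul_isLittleO hXT.norm_norm
    refine (Asymptotics.isLittleO_one_iff ℝ).1 (h.trans_isBigO ?_)
    exact (hN.norm.congr fun a => by simp).isBigO_one ℝ
  have hpow : Tendsto (fun a => X a * T a ^ N a - Complex.exp (ε a * c) ^ N a • X a) l (𝓝 0) := by
    refine squeeze_zero_norm (a := fun a => Real.exp (‖N a * ε a‖ * ‖c‖) *
      (N a * ‖X a * T a - Complex.exp (ε a * c) • X a‖)) (fun a => ?_) ?_
    · refine (norm_mul_pow_sub_smul_le (hT a) (Real.one_le_exp (norm_nonneg (ε a * c)))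
        (Complex.norm_exp_le_exp_norm _) le_rfl (N a)).trans_eq ?_
      rw [← Real.exp_nat_mul, norm_mul, norm_mul, norm_natCast, mul_assoc (N a : ℝ)]
      ring
    · simpa using ((Real.continuous_exp.tendsto _).comp (hN.norm.mul_const ‖c‖)).mul hdefect
  have hlead : Tendsto (fun a => Complex.exp (ε a * c) ^ N a • X a) l
      (𝓝 (Complex.exp (κ * c) • X₀)) := by
    refine Tendsto.smul (((Complex.continuous_exp.tendsto _).comp (hN.mul_const c)).congr ?_) hX
    intro a
    rw [Function.comp_apply, ← Complex.exp_nat_mul, mul_assoc]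
  have hstart : Tendsto (fun a => (X a - X₀) * T a ^ N a) l (𝓝 0) :=
    squeeze_zero_norm (fun a => norm_mul_pow_le _ (hT a) _) (by simpa using (hX.sub_const X₀).norm)
  have h := (hpow.add hlead).sub hstart
  rw [zero_add, sub_zero] at h
  exact h.congr fun a => by rw [sub_add_cancel, sub_mul, sub_sub_cancel]

variable {P M S G : 𝔸} {c : ℂ}

-- `A` and `B` cancel the orders `e` and `e²` of
-- `(P + e A + e² B) exp(e G) M - exp(e² c) (P + e A + e² B)`; the value of `c` is the solvability
-- condition at the second order.
theorem exists_left_eigenvector_correctors (hMP : M * P = P) (hPP : P * P = P)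
    (hS : S * (M - 1) = 1 - P) (hPGP : P * G * P = 0)
    (hc : c • P = -((1 / 2 : ℂ) • (P * G ^ 2 * P)) - P * G * S * G * P) :
    ∃ A B : 𝔸, A * M = A - P * G * M ∧
      B * M = B + (c • P - A * G * M - (1 / 2 : ℂ) • (P * G ^ 2 * M)) := by
  have hGS : P * G * S * M = P * G * S + P * G := mul_reduced_inverse_mul hS hPGP
  refine ⟨-(P * G * S + P * G), _, ?_, mul_reduced_inverse_mul hS ?_⟩
  · rw [neg_mul, add_mul, hGS]
    abel
  · simp only [neg_mul, sub_mul, add_mul, smul_mul_assoc, pow_two, mul_assoc, hMP, hPP] at hc ⊢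
    rw [hc]
    module

theorem exp_sub_taylor_two_isBigO [CompleteSpace 𝔸] (G : 𝔸) :
    (fun e : ℂ => NormedSpace.exp (e • G) - (1 + e • G + (e ^ 2 / 2) • G ^ 2))
      =O[𝓝 0] fun e => e ^ 3 := by
  have hG : Tendsto (fun e : ℂ => e • G) (𝓝 0) (𝓝 0) :=
    Continuous.tendsto' (by fun_prop) _ _ (zero_smul ℂ G)
  have taylor := ((NormedSpace.exp_hasFPowerSeriesAt_zero
    (𝕂 := ℂ) (𝔸 := 𝔸)).isBigO_sub_partialSum_pow 3).comp_tendsto hG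
  have hscale : (fun e : ℂ => ‖e • G‖ ^ 3) =O[𝓝 0] fun e => e ^ 3 := by
    refine Asymptotics.IsBigO.of_bound (‖G‖ ^ 3) (Eventually.of_forall fun e => le_of_eq ?_)
    rw [norm_pow, norm_norm, norm_pow, norm_smul, mul_pow, mul_comm]
  refine (taylor.trans hscale).congr_left fun e => ?_
  simp only [Function.comp_apply, zero_add, FormalMultilinearSeries.partialSum,
    Finset.sum_range_succ, Finset.sum_range_zero, NormedSpace.expSeries_apply_eq, smul_pow]
  norm_num [smul_smul, div_eq_inv_mul]

theorem approx_left_eigenvector_isLittleO [CompleteSpace 𝔸] {A B : 𝔸} (hPM : P * M = P)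
    (hA : A * M = A - P * G * M)
    (hB : B * M = B + (c • P - A * G * M - (1 / 2 : ℂ) • (P * G ^ 2 * M))) :
    (fun e : ℂ => (P + e • A + e ^ 2 • B) * (NormedSpace.exp (e • G) * M) -
      Complex.exp (e ^ 2 * c) • (P + e • A + e ^ 2 • B)) =o[𝓝 0] fun e => e ^ 2 := by
  let X : ℂ → 𝔸 := fun e => P + e • A + e ^ 2 • B
  have hX : Continuous X := by fun_prop
  have hcubic : (fun e : ℂ => e ^ 3) =o[𝓝 0] fun e => e ^ 2 :=
    Asymptotics.isLittleO_pow_pow (by norm_num)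
  have hremainder : (fun e : ℂ =>
      X e * (NormedSpace.exp (e • G) - (1 + e • G + (e ^ 2 / 2) • G ^ 2)) * M)
        =o[𝓝 0] fun e => e ^ 2 := by
    simpa using ((hX.tendsto 0).isBigO_one ℂ).mul_isLittleO
      ((exp_sub_taylor_two_isBigO G).trans_isLittleO hcubic) |>.mul_isBigO
        (Asymptotics.isBigO_const_one ℂ M (𝓝 0))
  have heigenvalue : (fun e : ℂ => (Complex.exp (e ^ 2 * c) - 1 - e ^ 2 * c) • X e)
      =o[𝓝 0] fun e => e ^ 2 := by
    have hexp : (fun z : ℂ => Complex.exp z - 1 - z) =o[𝓝 0] fun z => z := by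
      simpa [hasDerivAt_iff_isLittleO] using Complex.hasDerivAt_exp 0
    have hsq : Tendsto (fun e : ℂ => e ^ 2 * c) (𝓝 0) (𝓝 0) :=
      Continuous.tendsto' (by fun_prop) _ _ (by simp)
    have hscale : (fun e : ℂ => e ^ 2 * c) =O[𝓝 0] fun e => e ^ 2 := by
      simpa [mul_comm] using Asymptotics.isBigO_const_mul_self c (fun e : ℂ => e ^ 2) (𝓝 0)
    simpa using ((hexp.comp_tendsto hsq).trans_isBigO hscale).smul_isBigO
      ((hX.tendsto 0).isBigO_one ℂ)
  have hhigher (Q₀ Q₁ : 𝔸) : (fun e : ℂ => e ^ 3 • (Q₀ + e • Q₁)) =o[𝓝 0] fun e => e ^ 2 := by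
    have hQ : Continuous fun e : ℂ => Q₀ + e • Q₁ := by fun_prop
    simpa using hcubic.smul_isBigO ((hQ.tendsto 0).isBigO_one ℂ)
  refine ((hremainder.add (hhigher
    (B * G * M + (1 / 2 : ℂ) • (A * G ^ 2 * M) - c • A)
    ((1 / 2 : ℂ) • (B * G ^ 2 * M) - c • B))).sub heigenvalue).congr_left fun e => ?_
  have hXM : X e * M = X e - e • (P * G * M) +
      e ^ 2 • (c • P - A * G * M - (1 / 2 : ℂ) • (P * G ^ 2 * M)) := by
    simp only [X, add_mul, smul_mul_assoc, hPM, hA, hB]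
    module
  simp only [mul_sub, mul_add, sub_mul, add_mul, mul_one, mul_smul_comm, hXM]
  simp only [X, add_mul, smul_mul_assoc, mul_assoc]
  module

theorem tendsto_mul_pow_exp_mul [CompleteSpace 𝔸] (hPM : P * M = P) (hMP : M * P = P)
    (hPP : P * P = P) (hS : S * (M - 1) = 1 - P) (hPGP : P * G * P = 0)
    (hc : c • P = -((1 / 2 : ℂ) • (P * G ^ 2 * P)) - P * G * S * G * P)
    {ι : Type*} {l : Filter ι} {e : ι → ℂ} (he : Tendsto e l (𝓝 0))
    (hcontr : ∀ a, ‖NormedSpace.exp (e a • G) * M‖ ≤ 1)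
    {N : ι → ℕ} {κ : ℂ} (hN : Tendsto (fun a => N a * e a ^ 2) l (𝓝 κ)) :
    Tendsto (fun a => P * (NormedSpace.exp (e a • G) * M) ^ N a) l
      (𝓝 (Complex.exp (κ * c) • P)) := by
  obtain ⟨A, B, hA, hB⟩ := exists_left_eigenvector_correctors hMP hPP hS hPGP hc
  have hX : Tendsto (fun e : ℂ => P + e • A + e ^ 2 • B) (𝓝 0) (𝓝 P) :=
    Continuous.tendsto' (by fun_prop) _ _ (by simp)
  exact tendsto_mul_pow_of_approx_eigenvector hcontr (hX.comp he) hN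
    ((approx_left_eigenvector_isLittleO hPM hA hB).comp_tendsto he)

end Perturbation

section Resolvent

variable {ι K : Type*} [Fintype ι] [DecidableEq ι] [Field K] {M P : Matrix ι ι K}

theorem exists_smul_eq_of_charpoly_rootMultiplicity_le_one {a : K}
    (ha : M.charpoly.rootMultiplicity a ≤ 1) {x y : ι → K} (hx : M *ᵥ x = a • x) (hx0 : x ≠ 0)
    (hy : M *ᵥ y = a • y) : ∃ b : K, b • x = y := by
  have hfin : Module.finrank K (Module.End.eigenspace M.toLin' a) ≤ 1 :=
    (LinearMap.finrank_eigenspace_le _ _).trans (by rwa [Matrix.charpoly_toLin'])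
  obtain ⟨u, hu⟩ := finrank_le_one_iff.1 hfin
  obtain ⟨p, hp⟩ := hu ⟨x, Module.End.mem_eigenspace_iff.2 hx⟩
  obtain ⟨q, hq⟩ := hu ⟨y, Module.End.mem_eigenspace_iff.2 hy⟩
  have hpu : p • (u : ι → K) = x := congrArg Subtype.val hp
  have hqu : q • (u : ι → K) = y := congrArg Subtype.val hq
  have hp0 : p ≠ 0 := fun h => hx0 (by rw [← hpu, h, zero_smul])
  exact ⟨q * p⁻¹, by rw [← hpu, smul_smul, inv_mul_cancel_right₀ hp0, hqu]⟩

theorem det_sub_sub_one_ne_zero_of_simple (hPP : P * P = P) (hPM : P * M = P)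
    (hsimple : M.charpoly.rootMultiplicity 1 ≤ 1) {ψ : ι → K} (hψ : ψ ≠ 0) (hMψ : M *ᵥ ψ = ψ)
    (hPψ : P *ᵥ ψ = ψ) : (M - P - 1).det ≠ 0 := by
  intro hdet
  obtain ⟨x, hx0, hx⟩ := Matrix.exists_mulVec_eq_zero_iff.2 hdet
  have hPx : P *ᵥ x = 0 := by
    have h := congrArg (P *ᵥ ·) hx
    rw [Matrix.mulVec_mulVec, mul_sub, mul_sub, hPM, hPP, sub_self, zero_sub, mul_one,
      Matrix.neg_mulVec, Matrix.mulVec_zero] at h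
    exact neg_eq_zero.1 h
  have hMx : M *ᵥ x = x := by
    rw [Matrix.sub_mulVec, Matrix.sub_mulVec, Matrix.one_mulVec, hPx, sub_zero] at hx
    exact sub_eq_zero.1 hx
  obtain ⟨b, rfl⟩ := exists_smul_eq_of_charpoly_rootMultiplicity_le_one hsimple
    (by rw [hMψ, one_smul]) hψ (by rw [hMx, one_smul])
  rw [Matrix.mulVec_smul, hPψ] at hPx
  exact hx0 hPx

theorem inv_mul_one_sub_mul_sub_smul (hPP : P * P = P) (hMP : M * P = P) (hPM : P * M = P) {z : K}
    (hdet : (M - P - z • (1 : Matrix ι ι K)).det ≠ 0) :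
    (M - P - z • (1 : Matrix ι ι K))⁻¹ * (1 - P) * (M - z • (1 : Matrix ι ι K)) = 1 - P := by
  have hcomm : (1 - P) * (M - z • (1 : Matrix ι ι K)) =
      (M - P - z • (1 : Matrix ι ι K)) * (1 - P) := by
    simp only [mul_sub, sub_mul, one_mul, mul_one, smul_mul_assoc, mul_smul_comm, hPP, hMP, hPM]
    module
  rw [mul_assoc, hcomm, Matrix.nonsing_inv_mul_cancel_left _ _ hdet.isUnit]

theorem inv_sub_smul_eq_add (hPP : P * P = P) (hMP : M * P = P) (hPM : P * M = P) {z : K}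
    (hz : z ≠ 1) (hdet : (M - P - z • (1 : Matrix ι ι K)).det ≠ 0) :
    (M - z • (1 : Matrix ι ι K))⁻¹ =
      (1 - z)⁻¹ • P + (M - P - z • (1 : Matrix ι ι K))⁻¹ * (1 - P) := by
  refine Matrix.inv_eq_left_inv ?_
  rw [add_mul, inv_mul_one_sub_mul_sub_smul hPP hMP hPM hdet, smul_mul_assoc, mul_sub, hPM,
    mul_smul_comm, mul_one, show P - z • P = (1 - z) • P by rw [sub_smul, one_smul],
    inv_smul_smul₀ (sub_ne_zero.2 hz.symm), add_sub_cancel]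

theorem tendsto_inv_sub_smul_sub [TopologicalSpace K] [IsTopologicalDivisionRing K] [T1Space K]
    (hPP : P * P = P) (hMP : M * P = P) (hPM : P * M = P) (hdet : (M - P - 1).det ≠ 0) :
    Tendsto (fun z : K => (M - z • (1 : Matrix ι ι K))⁻¹ - (1 - z)⁻¹ • P) (𝓝[≠] 1)
      (𝓝 ((M - P - 1)⁻¹ * (1 - P))) := by
  have hB : Tendsto (fun z : K => M - P - z • (1 : Matrix ι ι K)) (𝓝[≠] 1) (𝓝 (M - P - 1)) :=
    (Continuous.tendsto' (by fun_prop) _ _ (by rw [one_smul])).mono_left nhdsWithin_le_nhds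
  have hinv : ContinuousAt Inv.inv (M - P - 1) :=
    continuousAt_matrix_inv _ (by rw [Ring.inverse_eq_inv']; exact continuousAt_inv₀ hdet)
  refine ((hinv.tendsto.comp hB).mul_const (1 - P)).congr' ?_
  have hdet_near : ∀ᶠ z in 𝓝[≠] (1 : K), (M - P - z • (1 : Matrix ι ι K)).det ≠ 0 :=
    ((continuous_id.matrix_det.tendsto _).comp hB).eventually_ne hdet
  filter_upwards [hdet_near, self_mem_nhdsWithin] with z hz hz1
  rw [inv_sub_smul_eq_add hPP hMP hPM hz1 hz, add_sub_cancel_left]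
  rfl

theorem mul_inv_sub_sub_one_mul_one_sub (hPP : P * P = P) (hPM : P * M = P)
    (hdet : (M - P - 1).det ≠ 0) : P * ((M - P - 1)⁻¹ * (1 - P)) = 0 := by
  have hPB : P * (M - P - 1) = -P := by
    rw [mul_sub, mul_sub, hPM, hPP, mul_one, sub_self, zero_sub]
  have hPB_inv : P * (M - P - 1)⁻¹ = -P := by
    rw [eq_neg_iff_add_eq_zero, ← neg_eq_iff_add_eq_zero, ← neg_mul, ← hPB,
      Matrix.mul_nonsing_inv_cancel_right _ _ hdet.isUnit]
  rw [← mul_assoc, hPB_inv, mul_sub, mul_one, neg_mul, hPP, sub_self]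

end Resolvent

section L2OpNorm

open scoped Matrix.Norms.L2Operator

variable {ι : Type*} [Fintype ι] [DecidableEq ι]

theorem norm_entry_le_l2_opNorm (A : Matrix ι ι ℂ) (i j : ι) : ‖A i j‖ ≤ ‖A‖ := by
  have h := A.l2_opNorm_mulVec (EuclideanSpace.single j (1 : ℂ))
  rw [PiLp.norm_single, norm_one, mul_one] at h
  refine le_trans ?_ ((PiLp.norm_apply_le _ i).trans h)
  simp [Matrix.mulVec_single]

theorem l2_opNorm_le_one_of_mem_unitary {A : Matrix ι ι ℂ} (hA : A ∈ unitary (Matrix ι ι ℂ)) :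
    ‖A‖ ≤ 1 := by
  rcases subsingleton_or_nontrivial (Matrix ι ι ℂ) with h | h
  · rw [Subsingleton.elim A 0, norm_zero]
    exact zero_le_one
  · exact (CStarRing.norm_of_mem_unitary hA).le

theorem l2_opNorm_diagonal_le {c : ℝ} (hc : 0 ≤ c) {f : ι → ℂ} (hf : ∀ i, ‖f i‖ ≤ c) :
    ‖(Matrix.diagonal f : Matrix ι ι ℂ)‖ ≤ c := by
  rw [Matrix.l2_opNorm_diagonal]
  exact (pi_norm_le_iff_of_nonneg hc).2 hf

theorem l2_opNorm_integral_le {Ω : Type*} [MeasurableSpace Ω] {μ : Measure Ω}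
    [IsProbabilityMeasure μ] {K : Ω → Matrix ι ι ℂ} (hK : ∀ i j, Measurable fun ω => K ω i j)
    {c : ℝ} (hc : ∀ ω, ‖K ω‖ ≤ c) : ‖Matrix.of fun i j => ∫ ω, K ω i j ∂μ‖ ≤ c := by
  have hmeas : AEStronglyMeasurable K μ :=
    (measurable_pi_iff.2 fun i => measurable_pi_iff.2 (hK i) :
      Measurable (β := ι → ι → ℂ) K).aestronglyMeasurable
  have hint : Integrable K μ := Integrable.of_bound hmeas c (ae_of_all _ hc)
  have hentry : (Matrix.of fun i j => ∫ ω, K ω i j ∂μ) = ∫ ω, K ω ∂μ := by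
    ext i j
    exact (LinearMap.toContinuousLinearMap (Matrix.entryLinearMap ℂ ℂ i j)).integral_comp_comm hint
  rw [hentry]
  simpa using norm_integral_le_of_norm_le_const (μ := μ) (ae_of_all _ hc)

end L2OpNorm

section Kernel

variable {d : ℕ}

theorem inner_ket (σ : Coin d) (x : Lattice d) (ψ : WalkSpace d) : inner ℂ (ket σ x) ψ = ψ x σ := by
  rw [ket, lp.inner_single_left, EuclideanSpace.inner_single_left]
  simp

theorem tensorId_apply (A : CoinSpace d →L[ℂ] CoinSpace d) (ψ : WalkSpace d) (x : Lattice d) :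
    tensorId A ψ x = A (ψ x) := rfl

theorem translation_apply (k : Lattice d) (ψ : WalkSpace d) (x : Lattice d) :
    translation k ψ x = ψ (x - k) := rfl

theorem coinOp_apply (A : CoinMatrix d) (u : CoinSpace d) (τ : Coin d) :
    coinOp A u τ = ∑ σ, A τ σ * u σ := by
  rw [coinOp, Matrix.ofLp_toEuclideanCLM]
  rfl

theorem coinOp_single_apply (σ τ : Coin d) (u : CoinSpace d) :
    coinOp (Matrix.single σ σ 1) u τ = if σ = τ then u τ else 0 := by
  rcases eq_or_ne σ τ with rfl | hστ
  · simp [coinOp_apply, Matrix.single_apply]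
  · simp [coinOp_apply, hστ]

theorem shift_apply (r : Coin d → Lattice d) (ψ : WalkSpace d) (x : Lattice d) (τ : Coin d) :
    shift r ψ x τ = ψ (x - r τ) τ := by
  have hsum : shift r ψ =
      ∑ σ : Coin d, tensorId (coinOp (Matrix.single σ σ 1)) (translation (r σ) ψ) := by
    simp only [shift, sum_apply, ContinuousLinearMap.comp_apply]
  rw [hsum, lp.coeFn_sum, Finset.sum_apply, WithLp.ofLp_sum, Finset.sum_apply]
  simp only [tensorId_apply, coinOp_single_apply, translation_apply, Finset.sum_ite_eq',
    Finset.mem_univ, if_true]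

/-- The operator `S (A ⊗ 𝕀)`, one step of the walk with coin matrix `A`. -/
def stepOp (r : Coin d → Lattice d) (A : CoinMatrix d) : WalkSpace d →L[ℂ] WalkSpace d :=
  shift r ∘L tensorId (coinOp A)

theorem stepOp_apply (r : Coin d → Lattice d) (A : CoinMatrix d) (ψ : WalkSpace d)
    (x : Lattice d) (τ : Coin d) : stepOp r A ψ x τ = ∑ σ, A τ σ * ψ (x - r τ) σ := by
  rw [stepOp, ContinuousLinearMap.comp_apply, shift_apply, tensorId_apply, coinOp_apply]

theorem adjoint_stepOp_ket (r : Coin d → Lattice d) (A : CoinMatrix d) (τ : Coin d)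
    (x : Lattice d) :
    (stepOp r A).adjoint (ket τ x) = ∑ σ, star (A τ σ) • ket σ (x - r τ) := by
  refine ext_inner_right ℂ fun ψ => ?_
  rw [ContinuousLinearMap.adjoint_inner_left, inner_ket, stepOp_apply, sum_inner]
  refine Finset.sum_congr rfl fun σ _ => ?_
  rw [inner_smul_left, inner_ket, starRingEnd_apply, star_star]

theorem kernel_apply (ρ : WalkSpace d →L[ℂ] WalkSpace d) (x y : Lattice d) (σ τ : Coin d) :
    kernel ρ x y σ τ = inner ℂ (ket σ x) (ρ (ket τ y)) := rfl

theorem kernel_stepOp_conj (r : Coin d → Lattice d) (A : CoinMatrix d)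
    (ρ : WalkSpace d →L[ℂ] WalkSpace d) (x y : Lattice d) (σ τ : Coin d) :
    kernel (stepOp r A ∘L ρ ∘L (stepOp r A).adjoint) x y σ τ =
      ∑ T : Coin d × Coin d,
        A σ T.1 * star (A τ T.2) * kernel ρ (x - r σ) (y - r τ) T.1 T.2 := by
  rw [kernel_apply, ContinuousLinearMap.comp_apply, ← ContinuousLinearMap.adjoint_inner_left,
    ContinuousLinearMap.comp_apply, adjoint_stepOp_ket, adjoint_stepOp_ket, map_sum, sum_inner]
  refine Eq.trans ?_ (Fintype.sum_prod_type _).symm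
  refine Finset.sum_congr rfl fun σ' _ => ?_
  rw [inner_sum]
  refine Finset.sum_congr rfl fun τ' _ => ?_
  rw [map_smul, inner_smul_left, inner_smul_right, starRingEnd_apply, star_star, kernel_apply,
    mul_assoc]

theorem evolved_zero (r : Coin d → Lattice d) (C : ℕ → CoinMatrix d)
    (ρ₀ : WalkSpace d →L[ℂ] WalkSpace d) : evolved r C ρ₀ 0 = ρ₀ := by
  rw [evolved, evolution, ContinuousLinearMap.adjoint_id, ContinuousLinearMap.comp_id,
    ContinuousLinearMap.id_comp]

theorem evolution_succ (r : Coin d → Lattice d) (C : ℕ → CoinMatrix d) (n : ℕ) :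
    evolution r C (n + 1) = stepOp r (C n) ∘L evolution r C n := rfl

theorem evolved_succ (r : Coin d → Lattice d) (C : ℕ → CoinMatrix d)
    (ρ₀ : WalkSpace d →L[ℂ] WalkSpace d) (n : ℕ) :
    evolved r C ρ₀ (n + 1) =
      stepOp r (C n) ∘L evolved r C ρ₀ n ∘L (stepOp r (C n)).adjoint := by
  rw [evolved, evolution_succ, ContinuousLinearMap.adjoint_comp, evolved,
    ContinuousLinearMap.comp_assoc, ContinuousLinearMap.comp_assoc,
    ContinuousLinearMap.comp_assoc]

end Kernel

section Independence

variable {ι : Type*} {Ω : ι → Type*} [∀ i, MeasurableSpace (Ω i)] (μ : ∀ i, Measure (Ω i))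
  [∀ i, IsProbabilityMeasure (μ i)]

theorem exists_measurable_comp_restrict [∀ i, Nonempty (Ω i)] {β : Type*} [MeasurableSpace β]
    {g : (∀ i, Ω i) → β} (hg : Measurable g) {s : Finset ι} (hgs : DependsOn g (s : Set ι)) :
    ∃ h : (∀ i : s, Ω i) → β, Measurable h ∧ g = h ∘ s.restrict := by
  classical
  let ω₀ : ∀ i, Ω i := fun i => Classical.arbitrary (Ω i)
  refine ⟨fun x => g (Function.updateFinset ω₀ s x), hg.comp measurable_updateFinset, ?_⟩
  ext ω
  refine hgs fun i hi => ?_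
  simp [Function.updateFinset, Finset.mem_coe.1 hi]

theorem indepFun_eval_of_dependsOn {β : Type*} [MeasurableSpace β] {g : (∀ i, Ω i) → β}
    (hg : Measurable g) {s : Finset ι} (hgs : DependsOn g (s : Set ι)) {i : ι} (hi : i ∉ s) :
    ProbabilityTheory.IndepFun (fun ω => ω i) g (Measure.infinitePi μ) := by
  have := fun i => (μ i).nonempty_of_neZero
  obtain ⟨h, hh, rfl⟩ := exists_measurable_comp_restrict hg hgs
  have hcoord : ProbabilityTheory.iIndepFun (fun i (ω : ∀ i, Ω i) => ω i) (Measure.infinitePi μ) :=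
    ProbabilityTheory.iIndepFun_infinitePi (X := fun _ x => x) fun _ => measurable_id
  have hfinset := hcoord.indepFun_finset {i} s (Finset.disjoint_singleton_left.2 hi)
    measurable_pi_apply
  exact hfinset.comp
    (measurable_pi_apply (⟨i, Finset.mem_singleton_self i⟩ : ({i} : Finset ι))) hh

theorem integral_infinitePi_eval_mul {𝕜 : Type*} [RCLike 𝕜] {i : ι} {f : Ω i → 𝕜}
    (hf : Measurable f) {g : (∀ i, Ω i) → 𝕜} (hg : Measurable g) {s : Finset ι}
    (hgs : DependsOn g (s : Set ι)) (hi : i ∉ s) :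
    ∫ ω, f (ω i) * g ω ∂Measure.infinitePi μ =
      (∫ x, f x ∂μ i) * ∫ ω, g ω ∂Measure.infinitePi μ := by
  have hindep := (indepFun_eval_of_dependsOn μ hg hgs hi).comp hf measurable_id
  have hf_eval := (hf.comp (measurable_pi_apply i)).aestronglyMeasurable
    (μ := Measure.infinitePi μ)
  refine (hindep.integral_fun_mul_eq_mul_integral hf_eval hg.aestronglyMeasurable).trans ?_
  rw [← Measure.infinitePi_map_eval μ i, integral_map (measurable_pi_apply i).aemeasurable
    hf.aestronglyMeasurable]
  rfl

end Independence

section Average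

variable {d : ℕ} {Ω : Type*}

theorem dependsOn_kernel_evolved (C : Ω → CoinMatrix d) (r : Coin d → Lattice d)
    (ρ₀ : WalkSpace d →L[ℂ] WalkSpace d) (n : ℕ) (x y : Lattice d) (σ τ : Coin d) :
    DependsOn (fun ω : ℕ → Ω => kernel (evolved r (fun k => C (ω k)) ρ₀ n) x y σ τ)
      (Finset.range n : Set ℕ) := by
  induction n generalizing x y σ τ with
  | zero => exact fun ω ω' _ => by simp only [evolved_zero]
  | succ n ih =>
    intro ω ω' h
    have hn : ω n = ω' n := h n (by simp)
    have hlt : ∀ i ∈ (Finset.range n : Set ℕ), ω i = ω' i := fun i hi =>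
      h i (Finset.coe_subset.2 (Finset.range_subset_range.2 n.le_succ) hi)
    simp only [evolved_succ, kernel_stepOp_conj, hn]
    exact Finset.sum_congr rfl fun T _ => congrArg _ (ih _ _ _ _ hlt)

variable [MeasurableSpace Ω] (μ : Measure Ω) [IsProbabilityMeasure μ] {C : Ω → CoinMatrix d}
  (r : Coin d → Lattice d) (ρ₀ : WalkSpace d →L[ℂ] WalkSpace d)

theorem measurable_pairEntry (hC : ∀ σ τ, Measurable fun ω => C ω σ τ) (S T : Coin d × Coin d) :
    Measurable fun ω => C ω S.1 T.1 * star (C ω S.2 T.2) :=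
  (hC _ _).mul (Complex.continuous_conj.measurable.comp (hC _ _))

theorem norm_pairEntry_le_one {A : CoinMatrix d} (hA : A ∈ Matrix.unitaryGroup (Coin d) ℂ)
    (S T : Coin d × Coin d) : ‖A S.1 T.1 * star (A S.2 T.2)‖ ≤ 1 := by
  rw [norm_mul, norm_star]
  exact mul_le_one₀ (entry_norm_bound_of_unitary hA _ _) (norm_nonneg _)
    (entry_norm_bound_of_unitary hA _ _)

theorem measurable_kernel_evolved (hC : ∀ σ τ, Measurable fun ω => C ω σ τ) (n : ℕ)
    (x y : Lattice d) (σ τ : Coin d) :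
    Measurable fun ω : ℕ → Ω => kernel (evolved r (fun k => C (ω k)) ρ₀ n) x y σ τ := by
  induction n generalizing x y σ τ with
  | zero => simp only [evolved_zero, measurable_const]
  | succ n ih =>
    simp only [evolved_succ, kernel_stepOp_conj]
    exact Finset.measurable_fun_sum _ fun T _ =>
      ((measurable_pairEntry hC (σ, τ) T).comp (measurable_pi_apply n)).mul (ih _ _ _ _)

theorem integrable_kernel_evolved (hC : ∀ σ τ, Measurable fun ω => C ω σ τ)
    (hU : ∀ ω, C ω ∈ Matrix.unitaryGroup (Coin d) ℂ) (n : ℕ) (x y : Lattice d) (σ τ : Coin d) :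
    Integrable (fun ω : ℕ → Ω => kernel (evolved r (fun k => C (ω k)) ρ₀ n) x y σ τ)
      (Measure.infinitePi fun _ : ℕ => μ) := by
  induction n generalizing x y σ τ with
  | zero => simp only [evolved_zero, integrable_const]
  | succ n ih =>
    simp only [evolved_succ, kernel_stepOp_conj]
    exact integrable_finsetSum _ fun T _ => (ih _ _ _ _).bdd_mul (c := 1)
      ((measurable_pairEntry hC (σ, τ) T).comp (measurable_pi_apply n)).aestronglyMeasurable
      (ae_of_all _ fun ω => norm_pairEntry_le_one (hU (ω n)) (σ, τ) T)

/-- The averaged kernel `𝔼 ρ_n(x, y)`, as a vector in `ℂ^{2d} ⊗ ℂ^{2d}`: the component along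
`|σ ⊗ τ⟩` is the matrix entry at `σ, τ`. -/
def averagedKernel (μ : Measure Ω) (C : Ω → CoinMatrix d) (r : Coin d → Lattice d)
    (ρ₀ : WalkSpace d →L[ℂ] WalkSpace d) (n : ℕ) (x y : Lattice d) :
    Coin d × Coin d → ℂ := fun T =>
  ∫ ω : ℕ → Ω, kernel (evolved r (fun k => C (ω k)) ρ₀ n) x y T.1 T.2
    ∂(Measure.infinitePi fun _ : ℕ => μ)

theorem averagedKernel_zero (C : Ω → CoinMatrix d) (x y : Lattice d) (T : Coin d × Coin d) :
    averagedKernel μ C r ρ₀ 0 x y T = kernel ρ₀ x y T.1 T.2 := by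
  simp [averagedKernel, evolved_zero]

theorem averagedKernel_succ (hC : ∀ σ τ, Measurable fun ω => C ω σ τ)
    (hU : ∀ ω, C ω ∈ Matrix.unitaryGroup (Coin d) ℂ) (n : ℕ) (x y : Lattice d)
    (S : Coin d × Coin d) :
    averagedKernel μ C r ρ₀ (n + 1) x y S =
      ∑ T, meanCoin μ C S T * averagedKernel μ C r ρ₀ n (x - r S.1) (y - r S.2) T := by
  simp only [averagedKernel, evolved_succ, kernel_stepOp_conj]
  rw [integral_finsetSum]
  · exact Finset.sum_congr rfl fun T _ => integral_infinitePi_eval_mul (fun _ => μ)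
      (measurable_pairEntry hC S T) (measurable_kernel_evolved r ρ₀ hC n _ _ _ _)
      (dependsOn_kernel_evolved C r ρ₀ n _ _ _ _) Finset.notMem_range_self
  · exact fun T _ => (integrable_kernel_evolved μ r ρ₀ hC hU n _ _ _ _).bdd_mul (c := 1)
      ((measurable_pairEntry hC S T).comp (measurable_pi_apply n)).aestronglyMeasurable
      (ae_of_all _ fun ω => norm_pairEntry_le_one (hU (ω n)) S T)

theorem averagedProb_eq_sum_averagedKernel (hC : ∀ σ τ, Measurable fun ω => C ω σ τ)
    (hU : ∀ ω, C ω ∈ Matrix.unitaryGroup (Coin d) ℂ) (n : ℕ) (z : Lattice d) :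
    averagedProb μ C r ρ₀ n z = ∑ τ, averagedKernel μ C r ρ₀ n z z (τ, τ) :=
  integral_finsetSum _ fun τ _ => integrable_kernel_evolved μ r ρ₀ hC hU n z z τ τ

end Average

section Phase

variable {d : ℕ}

theorem phase_add_right (y : Fin d → ℝ) (k l : Lattice d) :
    phase y (k + l) = phase y k * phase y l := by
  rw [phase, phase, phase, ← Complex.exp_add, ← mul_add, ← Complex.ofReal_add,
    ← Finset.sum_add_distrib]
  simp only [Pi.add_apply, Int.cast_add, mul_add]

theorem phase_add_left (y y' : Fin d → ℝ) (k : Lattice d) :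
    phase (y + y') k = phase y k * phase y' k := by
  rw [phase, phase, phase, ← Complex.exp_add, ← mul_add, ← Complex.ofReal_add,
    ← Finset.sum_add_distrib]
  simp only [Pi.add_apply, add_mul]

theorem phase_zero_left (k : Lattice d) : phase (0 : Fin d → ℝ) k = 1 := by
  simp [phase]

theorem norm_phase (y : Fin d → ℝ) (k : Lattice d) : ‖phase y k‖ = 1 := by
  rw [phase, mul_comm, Complex.norm_exp_ofReal_mul_I]

theorem phase_neg_mul_phase (y : Fin d → ℝ) (k : Lattice d) : phase (-y) k * phase y k = 1 := by
  rw [← phase_add_left, neg_add_cancel, phase_zero_left]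

theorem phase_neg_left (v : Fin d → ℝ) (k : Lattice d) : phase (-v) k = (phase v k)⁻¹ :=
  eq_inv_of_mul_eq_one_left (phase_neg_mul_phase v k)

theorem continuous_phase (k : Lattice d) : Continuous fun y : Fin d → ℝ => phase y k := by
  unfold phase
  fun_prop

theorem phase_eq_prod (y : Fin d → ℝ) (k : Lattice d) :
    phase y k = ∏ j, Complex.exp (I * k j * y j) := by
  rw [phase, ← Complex.exp_sum]
  congr 1
  push_cast
  rw [Finset.mul_sum]
  exact Finset.sum_congr rfl fun j _ => by ring

theorem phase_toIcoMod (v : Fin d → ℝ) (k : Lattice d) :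
    phase (fun j => toIcoMod Real.two_pi_pos 0 (v j)) k = phase v k := by
  rw [phase_eq_prod, phase_eq_prod]
  refine Finset.prod_congr rfl fun j _ => ?_
  rw [Complex.exp_eq_exp_iff_exists_int]
  refine ⟨-(k j * toIcoDiv Real.two_pi_pos 0 (v j)), ?_⟩
  simp only [toIcoMod, zsmul_eq_mul]
  push_cast
  ring

theorem setIntegral_Ico_exp_int_mul (k : ℤ) :
    ∫ x in Set.Ico 0 (2 * Real.pi), Complex.exp (I * k * x) =
      if k = 0 then ((2 * Real.pi : ℝ) : ℂ) else 0 := by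
  rw [integral_Ico_eq_integral_Ioc, ← intervalIntegral.integral_of_le (by positivity)]
  split_ifs with hk
  · simp [hk]
  · have hperiod : Complex.exp (I * k * ((2 * Real.pi : ℝ) : ℂ)) = 1 := by
      rw [← Complex.exp_int_mul_two_pi_mul_I k]
      congr 1
      push_cast
      ring
    rw [integral_exp_mul_complex (mul_ne_zero I_ne_zero (by exact_mod_cast hk)), hperiod]
    simp

theorem volume_restrict_torusBox :
    (volume : Measure (Fin d → ℝ)).restrict (torusBox d) =
      Measure.pi fun _ => (volume : Measure ℝ).restrict (Set.Ico 0 (2 * Real.pi)) := by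
  rw [torusBox, volume_pi, Measure.restrict_pi_pi]

instance isFiniteMeasure_restrict_torusBox :
    IsFiniteMeasure ((volume : Measure (Fin d → ℝ)).restrict (torusBox d)) := by
  rw [volume_restrict_torusBox]
  infer_instance

theorem torusIntegral_const_mul (c : ℂ) (f : (Fin d → ℝ) → ℂ) :
    torusIntegral (fun v => c * f v) = c * torusIntegral f := by
  simp only [torusIntegral, integral_const_mul, mul_left_comm]

theorem torusIntegral_phase (k : Lattice d) :
    torusIntegral (fun v => phase v k) = if k = 0 then 1 else 0 := by
  have hpi : ((2 * Real.pi : ℝ) : ℂ) ≠ 0 := by exact_mod_cast Real.two_pi_pos.ne'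
  rw [torusIntegral, volume_restrict_torusBox]
  simp only [phase_eq_prod]
  rw [integral_fintype_prod_eq_prod (𝕜 := ℂ) (fun j (x : ℝ) => Complex.exp (I * k j * x))]
  simp only [setIntegral_Ico_exp_int_mul]
  split_ifs with hk
  · subst hk
    simp only [Pi.zero_apply, if_true, Finset.prod_const, Finset.card_univ, Fintype.card_fin]
    exact inv_mul_cancel₀ (pow_ne_zero _ hpi)
  · obtain ⟨j, hj⟩ := Function.ne_iff.1 hk
    rw [Finset.prod_eq_zero (Finset.mem_univ j) (by simpa using hj), mul_zero]

theorem torusIntegral_tsum {β : Type*} [Countable β] {F : β → (Fin d → ℝ) → ℂ}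
    {b : β → ℝ} (hF : ∀ p, Continuous (F p)) (hb : Summable b) (hFb : ∀ p v, ‖F p v‖ ≤ b p) :
    torusIntegral (fun v => ∑' p, F p v) = ∑' p, torusIntegral (F p) := by
  have hint : ∀ p, IntegrableOn (F p) (torusBox d) := fun p =>
    Integrable.of_bound (hF p).aestronglyMeasurable (b p) (ae_of_all _ (hFb p))
  have hsum : Summable fun p => ∫ v in torusBox d, ‖F p v‖ := by
    refine Summable.of_nonneg_of_le (fun p => integral_nonneg fun v => norm_nonneg _) (fun p => ?_)
      (hb.mul_left ((volume.restrict (torusBox d)).real Set.univ))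
    simpa using integral_mono (hint p).norm (integrable_const (b p)) (hFb p)
  simp only [torusIntegral]
  rw [← integral_tsum_of_summable_integral_norm hint hsum, ← tsum_mul_left]

theorem phase_add_neg_mul_phase (y v : Fin d → ℝ) (k l : Lattice d) :
    phase (y + -v) k * phase v l = phase y k * phase v (l - k) := by
  have hl : phase v l = phase v (l - k) * phase v k := by
    rw [← phase_add_right, sub_add_cancel]
  rw [phase_add_left, hl]
  linear_combination phase y k * phase v (l - k) * phase_neg_mul_phase v k

theorem tsum_ite_snd_eq_fst {α β : Type*} [DecidableEq α] [AddCommMonoid β] [TopologicalSpace β]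
    (g : α × α → β) :
    ∑' p : α × α, (if p.2 = p.1 then g p else 0) = ∑' a, g (a, a) := by
  have hdiag : Function.Injective fun a : α => (a, a) := fun a b h => (Prod.mk.inj h).1
  rw [← hdiag.tsum_eq]
  · simp
  · rintro ⟨a, b⟩ hab
    obtain rfl : b = a := by
      by_contra h
      simp [h] at hab
    exact ⟨b, rfl⟩

theorem torusIntegral_tsum_phase {f : Lattice d × Lattice d → ℂ} (hf : Summable f)
    (y : Fin d → ℝ) :
    torusIntegral (fun v => ∑' p, phase (y + -v) p.1 * phase v p.2 * f p) =
      ∑' z, f (z, z) * phase y z := by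
  have hval : ∀ p : Lattice d × Lattice d,
      torusIntegral (fun v => phase (y + -v) p.1 * phase v p.2 * f p) =
        if p.2 = p.1 then f p * phase y p.1 else 0 := fun p => by
    have hphase : ∀ v, phase (y + -v) p.1 * phase v p.2 * f p =
        f p * phase y p.1 * phase v (p.2 - p.1) := fun v => by
      rw [phase_add_neg_mul_phase]
      ring
    simp only [hphase, torusIntegral_const_mul, torusIntegral_phase, sub_eq_zero, mul_ite, mul_one,
      mul_zero]
  rw [torusIntegral_tsum (fun p => ?_) hf.norm fun p v => ?_, tsum_congr hval,
    tsum_ite_snd_eq_fst fun p => f p * phase y p.1]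
  · have hshift : Continuous fun v => phase (y + -v) p.1 :=
      (continuous_phase p.1).comp (by fun_prop)
    exact (hshift.mul (continuous_phase p.2)).mul continuous_const
  · simp only [norm_mul, norm_phase, one_mul, le_refl]

end Phase

section Transform

variable {d : ℕ} {ρ₀ : WalkSpace d →L[ℂ] WalkSpace d}

theorem summable_phase_mul {f : Lattice d × Lattice d → ℂ} (hf : Summable f) (y y' : Fin d → ℝ) :
    Summable fun p => phase y p.1 * phase y' p.2 * f p :=
  Summable.of_norm (by simpa only [norm_mul, norm_phase, one_mul] using hf.norm)

theorem psiOne_dotProduct (w : Coin d × Coin d → ℂ) :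
    star (psiOne d) ⬝ᵥ w = ∑ τ, w (τ, τ) := by
  simp [dotProduct, psiOne, Fintype.sum_prod_type, apply_ite (star : ℂ → ℂ)]

theorem psiOne_dotProduct_fourierVec (y y' : Fin d → ℝ) :
    star (psiOne d) ⬝ᵥ fourierVec ρ₀ y y' = (fourierKernel ρ₀ y y').trace :=
  psiOne_dotProduct _

section Initial

variable (hρ : ∀ σ τ, Summable fun p : Lattice d × Lattice d => ‖kernel ρ₀ p.1 p.2 σ τ‖)

include hρ

theorem summable_phase_smul_kernel (y y' : Fin d → ℝ) :
    Summable fun p : Lattice d × Lattice d =>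
      (phase y p.1 * phase y' p.2) • kernel ρ₀ p.1 p.2 :=
  Pi.summable.2 fun σ => Pi.summable.2 fun τ => summable_phase_mul (hρ σ τ).of_norm y y'

theorem fourierKernel_apply (y y' : Fin d → ℝ) (σ τ : Coin d) :
    fourierKernel ρ₀ y y' σ τ = ∑' p : Lattice d × Lattice d,
      phase y p.1 * phase y' p.2 * kernel ρ₀ p.1 p.2 σ τ := by
  have h := (summable_phase_smul_kernel hρ y y').hasSum
  exact (Pi.hasSum.1 (Pi.hasSum.1 h σ) τ).tsum_eq.symm

theorem hasSum_fourierKernel_neg (v : Fin d → ℝ) :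
    HasSum (fun p : Lattice d × Lattice d => phase v p.2 • kernel ρ₀ p.1 (p.1 + p.2))
      (fourierKernel ρ₀ (-v) v) := by
  have h := (Equiv.hasSum_iff (Equiv.prodShear (Equiv.refl (Lattice d)) Equiv.addLeft)).2
    (summable_phase_smul_kernel hρ (-v) v).hasSum
  convert! h using 1
  funext p
  simp only [Function.comp, Equiv.prodShear_apply, Equiv.refl_apply, Equiv.coe_addLeft,
    phase_add_right, ← mul_assoc, phase_neg_mul_phase, one_mul]

theorem norm_fourierVec_le (y y' : Fin d → ℝ) (T : Coin d × Coin d) :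
    ‖fourierVec ρ₀ y y' T‖ ≤ ∑' p : Lattice d × Lattice d, ‖kernel ρ₀ p.1 p.2 T.1 T.2‖ := by
  rw [fourierVec, fourierKernel_apply hρ]
  refine (norm_tsum_le_tsum_norm ?_).trans (le_of_eq ?_) <;>
    simp only [norm_mul, norm_phase, one_mul]
  exact hρ _ _

theorem continuous_fourierVec {X : Type*} [TopologicalSpace X] {f g : X → Fin d → ℝ}
    (hf : Continuous f) (hg : Continuous g) : Continuous fun x => fourierVec ρ₀ (f x) (g x) := by
  refine continuous_pi fun T => ?_
  simp only [fourierVec, fourierKernel_apply hρ]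
  refine continuous_tsum (fun p => ?_) (hρ T.1 T.2) fun p x => ?_
  · exact (((continuous_phase p.1).comp hf).mul ((continuous_phase p.2).comp hg)).mul
      continuous_const
  · rw [norm_mul, norm_mul, norm_phase, norm_phase, one_mul, one_mul]

theorem torusIntegral_trace_fourierKernel :
    torusIntegral (fun v => (fourierKernel ρ₀ (-v) v).trace) = ∑' x, (kernel ρ₀ x x).trace := by
  have htrace : ∀ v : Fin d → ℝ, (fourierKernel ρ₀ (-v) v).trace =
      ∑' p : Lattice d × Lattice d,
        phase (0 + -v) p.1 * phase v p.2 * (kernel ρ₀ p.1 p.2).trace := fun v => by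
    rw [zero_add, fourierKernel]
    simpa only [Matrix.traceAddMonoidHom_apply, Matrix.trace_smul, smul_eq_mul] using
      (summable_phase_smul_kernel hρ (-v) v).map_tsum (Matrix.traceAddMonoidHom (Coin d) ℂ)
        continuous_id.matrix_trace
  have hsum : Summable fun p : Lattice d × Lattice d => (kernel ρ₀ p.1 p.2).trace :=
    summable_sum fun τ _ => (hρ τ τ).of_norm
  simp only [htrace, torusIntegral_tsum_phase hsum, phase_zero_left, mul_one]

end Initial

variable {Ω : Type*} [MeasurableSpace Ω]

/-- The Fourier transform `R_n(y,y') = ∑_{k,k'} e^{i(yk + y'k')} 𝔼 ρ_n(k,k')` of the averaged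
kernel, as a vector indexed by pairs of coin states like `fourierVec`. -/
def averagedTransform (μ : Measure Ω) (C : Ω → CoinMatrix d) (r : Coin d → Lattice d)
    (ρ₀ : WalkSpace d →L[ℂ] WalkSpace d) (n : ℕ) (y y' : Fin d → ℝ) (T : Coin d × Coin d) : ℂ :=
  ∑' p : Lattice d × Lattice d, phase y p.1 * phase y' p.2 * averagedKernel μ C r ρ₀ n p.1 p.2 T

variable (μ : Measure Ω) [IsProbabilityMeasure μ]
  {C : Ω → CoinMatrix d} (hC : ∀ σ τ, Measurable fun ω => C ω σ τ)
  (hU : ∀ ω, C ω ∈ Matrix.unitaryGroup (Coin d) ℂ) (r : Coin d → Lattice d)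
  (hρ : ∀ σ τ, Summable fun p : Lattice d × Lattice d => ‖kernel ρ₀ p.1 p.2 σ τ‖)

include hC hU hρ

theorem summable_averagedKernel (n : ℕ) (T : Coin d × Coin d) :
    Summable fun p : Lattice d × Lattice d => averagedKernel μ C r ρ₀ n p.1 p.2 T := by
  induction n generalizing T with
  | zero =>
    simp only [averagedKernel_zero]
    exact (hρ T.1 T.2).of_norm
  | succ n ih =>
    simp only [averagedKernel_succ μ r ρ₀ hC hU]
    refine summable_sum fun S _ => Summable.mul_left _ ?_
    exact (Equiv.subRight (r T.1, r T.2)).summable_iff.2 (ih S)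

theorem averagedTransform_succ (n : ℕ) (y y' : Fin d → ℝ) :
    averagedTransform μ C r ρ₀ (n + 1) y y' =
      meanTransfer μ C r y y' *ᵥ averagedTransform μ C r ρ₀ n y y' := by
  funext S
  have hsum := fun T => summable_phase_mul (summable_averagedKernel μ hC hU r hρ n T) y y'
  have hrhs : (meanTransfer μ C r y y' *ᵥ averagedTransform μ C r ρ₀ n y y') S =
      ∑ T, phase y (r S.1) * phase y' (r S.2) * meanCoin μ C S T *
        averagedTransform μ C r ρ₀ n y y' T := by
    simp only [Matrix.mulVec, dotProduct, meanTransfer, phaseMatrix, Matrix.diagonal_mul]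
  rw [hrhs, averagedTransform, ← (Equiv.addRight (r S.1, r S.2)).tsum_eq]
  simp only [averagedKernel_succ μ r ρ₀ hC hU, averagedTransform, ← tsum_mul_left]
  rw [← Summable.tsum_finsetSum fun T _ => (hsum T).mul_left _]
  refine tsum_congr fun p => ?_
  simp only [Equiv.coe_addRight, Prod.fst_add, Prod.snd_add, add_sub_cancel_right,
    phase_add_right, Finset.mul_sum]
  exact Finset.sum_congr rfl fun T _ => by ring

theorem averagedTransform_eq_pow_mulVec (n : ℕ) (y y' : Fin d → ℝ) :
    averagedTransform μ C r ρ₀ n y y' =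
      (meanTransfer μ C r y y') ^ n *ᵥ fourierVec ρ₀ y y' := by
  induction n with
  | zero =>
    funext T
    rw [pow_zero, Matrix.one_mulVec, fourierVec, fourierKernel_apply hρ, averagedTransform]
    simp only [averagedKernel_zero]
  | succ n ih =>
    rw [averagedTransform_succ μ hC hU r hρ, ih, Matrix.mulVec_mulVec, pow_succ']

theorem psiOne_dotProduct_averagedTransform (n : ℕ) (y y' : Fin d → ℝ) :
    star (psiOne d) ⬝ᵥ averagedTransform μ C r ρ₀ n y y' =
      ∑' p : Lattice d × Lattice d, phase y p.1 * phase y' p.2 *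
        ∑ τ, averagedKernel μ C r ρ₀ n p.1 p.2 (τ, τ) := by
  have hsum := fun τ => summable_phase_mul (summable_averagedKernel μ hC hU r hρ n (τ, τ)) y y'
  simp only [psiOne_dotProduct, averagedTransform, Finset.mul_sum]
  exact (Summable.tsum_finsetSum fun τ _ => hsum τ).symm

theorem charFn_eq_torusIntegral (n : ℕ) (y : Fin d → ℝ) :
    charFn μ C r ρ₀ n y = torusIntegral fun v =>
      star (psiOne d) ⬝ᵥ ((meanTransfer μ C r (y + -v) v) ^ n *ᵥ fourierVec ρ₀ (y + -v) v) := by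
  simp only [← averagedTransform_eq_pow_mulVec μ hC hU r hρ,
    psiOne_dotProduct_averagedTransform μ hC hU r hρ]
  rw [torusIntegral_tsum_phase
    (summable_sum fun τ _ => summable_averagedKernel μ hC hU r hρ n (τ, τ))]
  simp only [charFn, averagedProb_eq_sum_averagedKernel μ r ρ₀ hC hU]

end Transform

theorem kronecker_map_star_mem_unitary {n R : Type*} [Fintype n] [DecidableEq n]
    [CommRing R] [StarRing R] {A : Matrix n n R} (hA : A ∈ Matrix.unitaryGroup n R) :
    A ⊗ₖ A.map star ∈ Matrix.unitaryGroup (n × n) R :=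
  Matrix.kronecker_mem_unitary hA (Matrix.map_star_mem_unitaryGroup_iff.2 hA)

section Contraction

open scoped Matrix.Norms.L2Operator

variable {d : ℕ} {Ω : Type*} [MeasurableSpace Ω] (μ : Measure Ω) [IsProbabilityMeasure μ]
  {C : Ω → CoinMatrix d} (hC : ∀ σ τ, Measurable fun ω => C ω σ τ)
  (hU : ∀ ω, C ω ∈ Matrix.unitaryGroup (Coin d) ℂ) (r : Coin d → Lattice d)

include hC hU

theorem l2_opNorm_meanCoin_le_one : ‖meanCoin μ C‖ ≤ 1 :=
  l2_opNorm_integral_le (K := fun ω => C ω ⊗ₖ (C ω).map star)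
    (fun S T => measurable_pairEntry hC S T)
    fun ω => l2_opNorm_le_one_of_mem_unitary (kronecker_map_star_mem_unitary (hU ω))

theorem l2_opNorm_meanTransfer_le_one (y y' : Fin d → ℝ) : ‖meanTransfer μ C r y y'‖ ≤ 1 :=
  (norm_mul_le _ _).trans (mul_le_one₀
    (l2_opNorm_diagonal_le zero_le_one fun T => by rw [norm_mul, norm_phase, norm_phase, one_mul])
    (norm_nonneg _) (l2_opNorm_meanCoin_le_one μ hC hU))

end Contraction

section FixedVectors

variable {d : ℕ}

theorem mulVec_psiOne_apply (X : PairMatrix d) (S : Coin d × Coin d) :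
    (X *ᵥ psiOne d) S = ∑ τ, X S (τ, τ) := by
  simp [Matrix.mulVec, dotProduct, psiOne, Fintype.sum_prod_type]

variable {Ω : Type*} [MeasurableSpace Ω] (μ : Measure Ω) [IsProbabilityMeasure μ]
  {C : Ω → CoinMatrix d} (hC : ∀ σ τ, Measurable fun ω => C ω σ τ)
  (hU : ∀ ω, C ω ∈ Matrix.unitaryGroup (Coin d) ℂ) (r : Coin d → Lattice d)

include hC hU

theorem integrable_pairEntry (S T : Coin d × Coin d) :
    Integrable (fun ω => C ω S.1 T.1 * star (C ω S.2 T.2)) μ :=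
  Integrable.of_bound (measurable_pairEntry hC S T).aestronglyMeasurable 1
    (ae_of_all _ fun ω => norm_pairEntry_le_one (hU ω) S T)

theorem meanCoin_mulVec_psiOne : meanCoin μ C *ᵥ psiOne d = psiOne d := by
  funext S
  have hrows : ∀ ω, ∑ τ, C ω S.1 τ * star (C ω S.2 τ) = psiOne d S := fun ω =>
    congrFun₂ (Matrix.mem_unitaryGroup_iff.1 (hU ω)) S.1 S.2
  simp only [mulVec_psiOne_apply, meanCoin, Matrix.of_apply, Matrix.kroneckerMap_apply,
    Matrix.map_apply]
  rw [← integral_finsetSum _ fun τ _ => integrable_pairEntry μ hC hU S (τ, τ)]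
  simp only [hrows, integral_const, probReal_univ, one_smul]

theorem psiOne_vecMul_meanCoin : star (psiOne d) ᵥ* meanCoin μ C = star (psiOne d) := by
  funext T
  have hcols : ∀ ω, ∑ τ, C ω τ T.1 * star (C ω τ T.2) = star (psiOne d) T := fun ω => by
    have h := congrFun₂ (Matrix.mem_unitaryGroup_iff'.1 (hU ω)) T.2 T.1
    rw [Matrix.mul_apply, Matrix.one_apply] at h
    simp only [Matrix.star_apply] at h
    simp only [mul_comm (C ω _ T.1), h, psiOne, Pi.star_apply, eq_comm (a := T.1)]
    split_ifs <;> simp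
  simp only [Matrix.vecMul, psiOne_dotProduct, meanCoin, Matrix.of_apply,
    Matrix.kroneckerMap_apply, Matrix.map_apply]
  rw [← integral_finsetSum _ fun τ _ => integrable_pairEntry μ hC hU (τ, τ) T]
  simp only [hcols, integral_const, probReal_univ, one_smul]

theorem meanTransfer_neg_mulVec_psiOne (v : Fin d → ℝ) :
    meanTransfer μ C r (-v) v *ᵥ psiOne d = psiOne d := by
  rw [meanTransfer, ← Matrix.mulVec_mulVec, meanCoin_mulVec_psiOne μ hC hU, phaseMatrix]
  funext T
  rw [Matrix.mulVec_diagonal, psiOne]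
  split_ifs with hT
  · rw [hT, phase_neg_mul_phase, one_mul]
  · rw [mul_zero]

theorem psiOne_vecMul_meanTransfer_neg (v : Fin d → ℝ) :
    star (psiOne d) ᵥ* meanTransfer μ C r (-v) v = star (psiOne d) := by
  have hphase : star (psiOne d) ᵥ* phaseMatrix r (-v) v = star (psiOne d) := by
    funext T
    rw [phaseMatrix, Matrix.vecMul_diagonal, Pi.star_apply, psiOne]
    split_ifs with hT
    · rw [hT, phase_neg_mul_phase, mul_one]
    · rw [star_zero, zero_mul]
  rw [meanTransfer, ← Matrix.vecMul_vecMul, hphase, psiOne_vecMul_meanCoin μ hC hU]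

theorem meanTransfer_neg_mul_projPsi (v : Fin d → ℝ) :
    meanTransfer μ C r (-v) v * projPsi d = projPsi d := by
  rw [projPsi, mul_smul_comm, Matrix.mul_vecMulVec, meanTransfer_neg_mulVec_psiOne μ hC hU]

theorem projPsi_mul_meanTransfer_neg (v : Fin d → ℝ) :
    projPsi d * meanTransfer μ C r (-v) v = projPsi d := by
  rw [projPsi, smul_mul_assoc, Matrix.vecMulVec_mul, psiOne_vecMul_meanTransfer_neg μ hC hU]

end FixedVectors

section Projection

variable {d : ℕ}

theorem projPsi_mul_mul_projPsi (X : PairMatrix d) :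
    projPsi d * X * projPsi d =
      ((2 * d : ℂ)⁻¹ * ∑ σ, ∑ τ, X (σ, σ) (τ, τ)) • projPsi d := by
  have hentry : star (psiOne d) ᵥ* X ⬝ᵥ psiOne d = ∑ σ, ∑ τ, X (σ, σ) (τ, τ) := by
    simp only [← Matrix.dotProduct_mulVec, psiOne_dotProduct, mulVec_psiOne_apply]
  rw [projPsi, smul_mul_assoc, smul_mul_assoc, mul_smul_comm, Matrix.vecMulVec_mul,
    Matrix.vecMulVec_mul_vecMulVec, hentry]
  simp only [smul_smul, Matrix.vecMulVec_smul]
  ring_nf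

theorem psiOne_dotProduct_self : star (psiOne d) ⬝ᵥ psiOne d = 2 * d := by
  rw [psiOne_dotProduct]
  simp [psiOne, mul_comm]

variable [NeZero d]

theorem psiOne_vecMul_projPsi : star (psiOne d) ᵥ* projPsi d = star (psiOne d) := by
  have hd : (d : ℂ) ≠ 0 := NeZero.ne _
  rw [projPsi, Matrix.vecMul_smul, Matrix.vecMul_vecMulVec, psiOne_dotProduct_self, smul_smul,
    inv_mul_cancel₀ (mul_ne_zero two_ne_zero hd), one_smul]

theorem projPsi_mulVec_psiOne : projPsi d *ᵥ psiOne d = psiOne d := by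
  have hd : (d : ℂ) ≠ 0 := NeZero.ne _
  rw [projPsi, Matrix.smul_mulVec, Matrix.vecMulVec_mulVec, psiOne_dotProduct_self,
    op_smul_eq_smul, smul_smul, inv_mul_cancel₀ (mul_ne_zero two_ne_zero hd), one_smul]

theorem projPsi_mul_self : projPsi d * projPsi d = projPsi d := by
  nth_rw 2 [projPsi]
  rw [mul_smul_comm, Matrix.mul_vecMulVec, projPsi_mulVec_psiOne, projPsi]

theorem psiOne_ne_zero : psiOne d ≠ 0 := fun h =>
  NeZero.ne (2 * d : ℂ) (by rw [← psiOne_dotProduct_self, h, dotProduct_zero])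

end Projection

section ReducedResolvent

variable {d : ℕ} {Ω : Type*} [MeasurableSpace Ω] (μ : Measure Ω) {C : Ω → CoinMatrix d}
  {r : Coin d → Lattice d}
  (hsimple : ∀ v ∈ torusBox d, (meanTransfer μ C r (-v) v).charpoly.rootMultiplicity 1 = 1)

include hsimple

theorem neZero_of_rootMultiplicity_meanTransfer : NeZero d := by
  refine ⟨?_⟩
  rintro rfl
  refine one_ne_zero ((hsimple 0 fun j _ => j.elim0).symm.trans ?_)
  exact Polynomial.rootMultiplicity_eq_zero (by simp)

theorem rootMultiplicity_meanTransfer_neg (v : Fin d → ℝ) :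
    (meanTransfer μ C r (-v) v).charpoly.rootMultiplicity 1 = 1 := by
  have hperiodic : meanTransfer μ C r (-v) v = meanTransfer μ C r
      (-fun j => toIcoMod Real.two_pi_pos 0 (v j)) fun j => toIcoMod Real.two_pi_pos 0 (v j) := by
    simp only [meanTransfer, phaseMatrix, phase_neg_left, phase_toIcoMod]
  rw [hperiodic]
  refine hsimple _ fun j _ => ?_
  simpa only [zero_add] using toIcoMod_mem_Ico Real.two_pi_pos 0 (v j)

variable [NeZero d] [IsProbabilityMeasure μ] (hC : ∀ σ τ, Measurable fun ω => C ω σ τ)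
  (hU : ∀ ω, C ω ∈ Matrix.unitaryGroup (Coin d) ℂ)

include hC hU

theorem det_meanTransfer_neg_sub_projPsi_sub_one_ne_zero (v : Fin d → ℝ) :
    (meanTransfer μ C r (-v) v - projPsi d - 1).det ≠ 0 :=
  det_sub_sub_one_ne_zero_of_simple projPsi_mul_self (projPsi_mul_meanTransfer_neg μ hC hU r v)
    (rootMultiplicity_meanTransfer_neg μ hsimple v).le psiOne_ne_zero
    (meanTransfer_neg_mulVec_psiOne μ hC hU r v) projPsi_mulVec_psiOne

theorem tendsto_reducedResolvent_inv_mul (v : Fin d → ℝ) :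
    Tendsto (reducedResolvent μ C r v) (𝓝[≠] (1 : ℂ))
      (𝓝 ((meanTransfer μ C r (-v) v - projPsi d - 1)⁻¹ * (1 - projPsi d))) :=
  tendsto_inv_sub_smul_sub projPsi_mul_self (meanTransfer_neg_mul_projPsi μ hC hU r v)
    (projPsi_mul_meanTransfer_neg μ hC hU r v)
    (det_meanTransfer_neg_sub_projPsi_sub_one_ne_zero μ hsimple hC hU v)

theorem reducedResolventOne_eq (v : Fin d → ℝ) :
    reducedResolventOne μ C r v =
      (meanTransfer μ C r (-v) v - projPsi d - 1)⁻¹ * (1 - projPsi d) :=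
  (tendsto_reducedResolvent_inv_mul μ hsimple hC hU v).limUnder_eq

theorem tendsto_reducedResolvent (v : Fin d → ℝ) :
    Tendsto (reducedResolvent μ C r v) (𝓝[≠] (1 : ℂ)) (𝓝 (reducedResolventOne μ C r v)) := by
  rw [reducedResolventOne_eq μ hsimple hC hU]
  exact tendsto_reducedResolvent_inv_mul μ hsimple hC hU v

theorem reducedResolventOne_mul_meanTransfer_sub_one (v : Fin d → ℝ) :
    reducedResolventOne μ C r v * (meanTransfer μ C r (-v) v - 1) = 1 - projPsi d := by
  have hdet := det_meanTransfer_neg_sub_projPsi_sub_one_ne_zero μ hsimple hC hU v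
  rw [← one_smul ℂ (1 : PairMatrix d)] at hdet
  simpa only [reducedResolventOne_eq μ hsimple hC hU, one_smul] using
    inv_mul_one_sub_mul_sub_smul projPsi_mul_self (meanTransfer_neg_mul_projPsi μ hC hU r v)
      (projPsi_mul_meanTransfer_neg μ hC hU r v) hdet

theorem reducedResolventOne_mul_projPsi (v : Fin d → ℝ) :
    reducedResolventOne μ C r v * projPsi d = 0 := by
  rw [reducedResolventOne_eq μ hsimple hC hU, mul_assoc, sub_mul, projPsi_mul_self, one_mul,
    sub_self, mul_zero]

theorem projPsi_mul_reducedResolventOne (v : Fin d → ℝ) :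
    projPsi d * reducedResolventOne μ C r v = 0 := by
  rw [reducedResolventOne_eq μ hsimple hC hU]
  exact mul_inv_sub_sub_one_mul_one_sub projPsi_mul_self (projPsi_mul_meanTransfer_neg μ hC hU r v)
    (det_meanTransfer_neg_sub_projPsi_sub_one_ne_zero μ hsimple hC hU v)

end ReducedResolvent

section DiffusionForm

variable {d : ℕ} (r : Coin d → Lattice d) (y : Fin d → ℝ)

/-- The displacement `y r(τ) = ∑_j y_j r(τ)_j` in the direction `y`. -/
def jump (τ : Coin d) : ℝ := ∑ j, y j * (r τ j : ℝ)

/-- The displacement `y r(τ) - y r̄` relative to the mean one. -/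
def centredJump (τ : Coin d) : ℝ := jump r y τ - drift r y

/-- Multiplication by the centred displacement of the first tensor factor: the generator of the
dependence of `ℳ(y - v, v)` on `y`, once the drift is removed. -/
def jumpMatrix : PairMatrix d := Matrix.diagonal fun T => (centredJump r y T.1 : ℂ)

theorem dotProduct_ofReal_eq_jump (τ : Coin d) :
    (fun j => (y j : ℂ)) ⬝ᵥ (fun j => (r τ j : ℂ)) = jump r y τ := by
  simp [dotProduct, jump]

theorem dotProduct_ofReal_eq_drift :
    (fun j => (y j : ℂ)) ⬝ᵥ (fun j => (meanJump r j : ℂ)) = drift r y := by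
  simp [dotProduct, drift]

theorem diffusionMatrix_eq_sum_vecMulVec {Ω : Type*} [MeasurableSpace Ω] (μ : Measure Ω)
    (C : Ω → CoinMatrix d) (v : Fin d → ℝ) :
    diffusionMatrix μ C r v = -(d : ℂ)⁻¹ •
      (∑ τ, (1 / 2 : ℂ) • Matrix.vecMulVec (fun j => (r τ j : ℂ)) (fun j => (r τ j : ℂ)) +
        ∑ τ, ∑ τ', ((reducedResolventOne μ C r v (τ, τ) (τ', τ') - (2 * d : ℂ)⁻¹) / 2) •
          (Matrix.vecMulVec (fun j => (r τ j : ℂ)) (fun j => (r τ' j : ℂ)) +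
            Matrix.vecMulVec (fun j => (r τ' j : ℂ)) (fun j => (r τ j : ℂ)))) -
      Matrix.vecMulVec (fun j => (meanJump r j : ℂ)) (fun j => (meanJump r j : ℂ)) := by
  ext j k
  simp only [diffusionMatrix, secondOrderMatrix, Matrix.sub_apply, Matrix.of_apply,
    Matrix.smul_apply, Matrix.add_apply, Matrix.sum_apply, Matrix.vecMulVec_apply, smul_eq_mul,
    Complex.ofReal_mul]
  congr 3
  · exact Finset.sum_congr rfl fun τ _ => by ring
  · exact Finset.sum_congr rfl fun τ _ => Finset.sum_congr rfl fun τ' _ => by ring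

theorem diffusionForm_eq {Ω : Type*} [MeasurableSpace Ω] (μ : Measure Ω)
    (C : Ω → CoinMatrix d) (v : Fin d → ℝ) :
    diffusionForm μ C r v y = -(d : ℂ)⁻¹ * ((∑ τ, (jump r y τ : ℂ) ^ 2) / 2 +
      ∑ τ, ∑ τ', (jump r y τ : ℂ) * jump r y τ' *
        (reducedResolventOne μ C r v (τ, τ) (τ', τ') - (2 * d : ℂ)⁻¹)) -
      (drift r y : ℂ) ^ 2 := by
  rw [diffusionForm, diffusionMatrix_eq_sum_vecMulVec]
  simp only [Matrix.sub_mulVec, Matrix.add_mulVec, Matrix.smul_mulVec, Matrix.sum_mulVec,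
    Matrix.vecMulVec_mulVec, dotProduct_sub, dotProduct_add, dotProduct_smul, dotProduct_sum,
    op_smul_eq_smul, smul_eq_mul, dotProduct_comm _ fun j => (y j : ℂ), dotProduct_ofReal_eq_jump,
    dotProduct_ofReal_eq_drift, Finset.sum_div, sq]
  congr 3
  · exact Finset.sum_congr rfl fun τ _ => by ring
  · exact Finset.sum_congr rfl fun τ _ => Finset.sum_congr rfl fun τ' _ => by ring

theorem sum_diagonal_fst (f : Coin d → ℂ) :
    ∑ σ, ∑ τ, (Matrix.diagonal (fun T : Coin d × Coin d => f T.1) : PairMatrix d) (σ, σ) (τ, τ) =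
      ∑ σ, f σ := by
  simp [Matrix.diagonal_apply]

theorem jumpMatrix_eq_diagonal_sub : jumpMatrix r y =
    Matrix.diagonal (fun T : Coin d × Coin d => (jump r y T.1 : ℂ)) -
      (drift r y : ℂ) • (1 : PairMatrix d) := by
  rw [jumpMatrix, ← Matrix.diagonal_one, ← Matrix.diagonal_smul, Matrix.diagonal_sub]
  congr 1
  funext T
  simp [centredJump]

theorem projPsi_mul_jumpMatrix_mul_mul_jumpMatrix_mul_projPsi {S : PairMatrix d}
    (hSP : S * projPsi d = 0) (hPS : projPsi d * S = 0) :
    projPsi d * jumpMatrix r y * S * jumpMatrix r y * projPsi d =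
      ((2 * d : ℂ)⁻¹ * ∑ σ, ∑ τ, (jump r y σ : ℂ) * jump r y τ * S (σ, σ) (τ, τ)) • projPsi d := by
  set G : PairMatrix d := Matrix.diagonal fun T : Coin d × Coin d => (jump r y T.1 : ℂ) with hG
  have hleft : projPsi d * jumpMatrix r y * S = projPsi d * G * S := by
    rw [jumpMatrix_eq_diagonal_sub, mul_sub, sub_mul, mul_smul_comm, mul_one, smul_mul_assoc, hPS,
      smul_zero, sub_zero]
  have hright : S * (jumpMatrix r y * projPsi d) = S * (G * projPsi d) := by
    rw [jumpMatrix_eq_diagonal_sub, sub_mul, mul_sub, smul_mul_assoc, one_mul, mul_smul_comm, hSP,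
      smul_zero, sub_zero]
  have huncentred : projPsi d * jumpMatrix r y * S * jumpMatrix r y * projPsi d =
      projPsi d * (G * S * G) * projPsi d := by
    rw [hleft]
    simp only [mul_assoc, hright]
  rw [huncentred, projPsi_mul_mul_projPsi]
  simp only [hG, Matrix.mul_diagonal, Matrix.diagonal_mul, mul_right_comm]

variable [NeZero d]

theorem sum_jump : ∑ τ, jump r y τ = 2 * d * drift r y := by
  have hd : (d : ℝ) ≠ 0 := NeZero.ne _
  simp only [jump, drift, meanJump, Finset.mul_sum]
  rw [Finset.sum_comm]
  exact Finset.sum_congr rfl fun j _ => Finset.sum_congr rfl fun τ _ => by field_simp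

theorem sum_centredJump : ∑ τ, centredJump r y τ = 0 := by
  simp only [centredJump, Finset.sum_sub_distrib, sum_jump r y]
  simp
  ring

theorem sum_centredJump_sq :
    ∑ τ, centredJump r y τ ^ 2 = ∑ τ, jump r y τ ^ 2 - 2 * d * drift r y ^ 2 := by
  have hsq : ∀ τ, centredJump r y τ ^ 2 =
      jump r y τ ^ 2 - drift r y * centredJump r y τ - drift r y * jump r y τ := fun τ => by
    rw [centredJump]
    ring
  simp only [hsq, Finset.sum_sub_distrib, ← Finset.mul_sum, sum_jump, sum_centredJump]
  ring

theorem projPsi_mul_jumpMatrix_mul_projPsi : projPsi d * jumpMatrix r y * projPsi d = 0 := by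
  rw [projPsi_mul_mul_projPsi, jumpMatrix, sum_diagonal_fst fun τ => (centredJump r y τ : ℂ),
    ← Complex.ofReal_sum, sum_centredJump, Complex.ofReal_zero, mul_zero, zero_smul]

theorem projPsi_mul_jumpMatrix_sq_mul_projPsi :
    projPsi d * jumpMatrix r y ^ 2 * projPsi d =
      ((2 * d : ℂ)⁻¹ * ((∑ τ, (jump r y τ : ℂ) ^ 2) - 2 * d * (drift r y : ℂ) ^ 2)) •
        projPsi d := by
  have hsq : jumpMatrix r y ^ 2 =
      Matrix.diagonal fun T : Coin d × Coin d => (centredJump r y T.1 : ℂ) ^ 2 := by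
    rw [jumpMatrix, Matrix.diagonal_pow]
    rfl
  rw [hsq, projPsi_mul_mul_projPsi, sum_diagonal_fst fun τ => (centredJump r y τ : ℂ) ^ 2]
  congr 2
  exact_mod_cast congrArg Complex.ofReal (sum_centredJump_sq r y)

theorem diffusionForm_smul_projPsi {Ω : Type*} [MeasurableSpace Ω] (μ : Measure Ω)
    (C : Ω → CoinMatrix d) (v : Fin d → ℝ)
    (hSP : reducedResolventOne μ C r v * projPsi d = 0)
    (hPS : projPsi d * reducedResolventOne μ C r v = 0) :
    (-(1 / 2) * diffusionForm μ C r v y) • projPsi d =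
      (1 / 2 : ℂ) • (projPsi d * jumpMatrix r y ^ 2 * projPsi d) +
        projPsi d * jumpMatrix r y * reducedResolventOne μ C r v * jumpMatrix r y * projPsi d := by
  have hd : (d : ℂ) ≠ 0 := NeZero.ne _
  have hjump : ∑ τ, ∑ τ', (jump r y τ : ℂ) * jump r y τ' = (2 * d * (drift r y : ℂ)) ^ 2 := by
    rw [← Finset.sum_mul_sum, ← Complex.ofReal_sum, sum_jump r y, ← sq]
    push_cast
    rfl
  rw [projPsi_mul_jumpMatrix_sq_mul_projPsi,
    projPsi_mul_jumpMatrix_mul_mul_jumpMatrix_mul_projPsi r y hSP hPS, smul_smul, ← add_smul,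
    diffusionForm_eq]
  simp only [mul_sub, Finset.sum_sub_distrib, ← Finset.sum_mul, hjump]
  congr 1
  field_simp
  ring

end DiffusionForm

section Scaling

open scoped Matrix.Norms.L2Operator

variable {d : ℕ} {Ω : Type*} [MeasurableSpace Ω] (μ : Measure Ω) {C : Ω → CoinMatrix d}
  {r : Coin d → Lattice d} {ρ₀ : WalkSpace d →L[ℂ] WalkSpace d}

theorem exp_drift_mul_phase (y : Fin d → ℝ) (e : ℝ) (τ : Coin d) :
    Complex.exp (-(I * (e * drift r y : ℝ))) * phase (e • y) (r τ) =
      Complex.exp (I * e * centredJump r y τ) := by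
  rw [phase, ← Complex.exp_add, centredJump, jump]
  congr 1
  simp only [Pi.smul_apply, smul_eq_mul, mul_assoc, ← Finset.mul_sum]
  push_cast
  ring

theorem exp_drift_smul_meanTransfer (y v : Fin d → ℝ) (e : ℝ) :
    Complex.exp (-(I * (e * drift r y : ℝ))) • meanTransfer μ C r (e • y + -v) v =
      NormedSpace.exp ((I * e) • jumpMatrix r y) * meanTransfer μ C r (-v) v := by
  rw [meanTransfer, meanTransfer, ← mul_assoc, ← smul_mul_assoc]
  congr 1
  simp only [phaseMatrix, jumpMatrix, ← Matrix.diagonal_smul, Matrix.exp_diagonal,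
    Matrix.diagonal_mul_diagonal]
  congr 1
  funext T
  rw [Pi.coe_exp, Pi.smul_apply, Pi.smul_apply, smul_eq_mul, smul_eq_mul, ← Complex.exp_eq_exp_ℂ,
    ← exp_drift_mul_phase, phase_add_left, mul_assoc, mul_assoc]

/-- The integrand over `v` of the Fourier representation of `e^{-i N ε y r̄} Φ_N(ε y)`. -/
def centredIntegrand (C : Ω → CoinMatrix d) (r : Coin d → Lattice d)
    (ρ₀ : WalkSpace d →L[ℂ] WalkSpace d) (y : Fin d → ℝ) (N : ℕ) (e : ℝ) (v : Fin d → ℝ) : ℂ :=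
  Complex.exp (-(I * N * (e * drift r y : ℝ))) *
    (star (psiOne d) ⬝ᵥ (meanTransfer μ C r (e • y + -v) v ^ N *ᵥ fourierVec ρ₀ (e • y + -v) v))

/-- The limit of `centredIntegrand` as `ε → 0` and `N ε² → κ`. -/
def limitIntegrand (C : Ω → CoinMatrix d) (r : Coin d → Lattice d)
    (ρ₀ : WalkSpace d →L[ℂ] WalkSpace d) (y : Fin d → ℝ) (κ : ℝ) (v : Fin d → ℝ) : ℂ :=
  Complex.exp (-(κ / 2) * diffusionForm μ C r v y) *
    (star (psiOne d) ⬝ᵥ fourierVec ρ₀ (-v) v)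

theorem limitIntegrand_eq_trace (y : Fin d → ℝ) (κ : ℝ) :
    limitIntegrand μ C r ρ₀ y κ = fun v =>
      Complex.exp (-(κ / 2) * diffusionForm μ C r v y) * (fourierKernel ρ₀ (-v) v).trace := by
  funext v
  rw [limitIntegrand, psiOne_dotProduct_fourierVec]

theorem centredIntegrand_eq [NeZero d] (y : Fin d → ℝ) (N : ℕ) (e : ℝ) (v : Fin d → ℝ) :
    centredIntegrand μ C r ρ₀ y N e v =
      star (psiOne d) ⬝ᵥ ((projPsi d * (NormedSpace.exp ((I * e) • jumpMatrix r y) *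
        meanTransfer μ C r (-v) v) ^ N) *ᵥ fourierVec ρ₀ (e • y + -v) v) := by
  rw [← exp_drift_smul_meanTransfer, smul_pow, mul_smul_comm, Matrix.smul_mulVec,
    dotProduct_smul, ← Matrix.mulVec_mulVec, Matrix.dotProduct_mulVec _ (projPsi d),
    psiOne_vecMul_projPsi, smul_eq_mul, ← Complex.exp_nat_mul, centredIntegrand]
  congr 2
  ring

theorem continuous_meanTransfer {X : Type*} [TopologicalSpace X] {f g : X → Fin d → ℝ}
    (hf : Continuous f) (hg : Continuous g) :
    Continuous fun x => meanTransfer μ C r (f x) (g x) := by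
  unfold meanTransfer phaseMatrix
  refine Continuous.matrix_mul (Continuous.matrix_diagonal (continuous_pi fun T => ?_))
    continuous_const
  exact ((continuous_phase _).comp hf).mul ((continuous_phase _).comp hg)

variable (hρ : ∀ σ τ, Summable fun p : Lattice d × Lattice d => ‖kernel ρ₀ p.1 p.2 σ τ‖)

include hρ in
theorem continuous_centredIntegrand (y : Fin d → ℝ) (N : ℕ) (e : ℝ) :
    Continuous (centredIntegrand μ C r ρ₀ y N e) := by
  have hline : Continuous fun v : Fin d → ℝ => e • y + -v := by fun_prop
  exact continuous_const.mul (continuous_const.dotProduct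
    (((continuous_meanTransfer μ hline continuous_id).pow N).matrix_mulVec
      (continuous_fourierVec hρ hline continuous_id)))

include hρ in
theorem torusIntegral_limitIntegrand_zero (y : Fin d → ℝ) :
    torusIntegral (limitIntegrand μ C r ρ₀ y 0) = ∑' x, (kernel ρ₀ x x).trace := by
  rw [limitIntegrand_eq_trace, ← torusIntegral_trace_fourierKernel hρ]
  simp only [Complex.ofReal_zero, zero_div, neg_zero, zero_mul, Complex.exp_zero, one_mul]

variable [IsProbabilityMeasure μ] (hC : ∀ σ τ, Measurable fun ω => C ω σ τ)
  (hU : ∀ ω, C ω ∈ Matrix.unitaryGroup (Coin d) ℂ)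

theorem norm_psiOne_dotProduct_mulVec_le (X : PairMatrix d) (w : Coin d × Coin d → ℂ) :
    ‖star (psiOne d) ⬝ᵥ (X *ᵥ w)‖ ≤ ∑ _τ : Coin d, ∑ T, ‖X‖ * ‖w T‖ := by
  rw [psiOne_dotProduct]
  refine norm_sum_le_of_le _ fun τ _ => norm_sum_le_of_le _ fun T _ => ?_
  rw [norm_mul]
  exact mul_le_mul_of_nonneg_right (norm_entry_le_l2_opNorm X _ T) (norm_nonneg _)

include hC hU in
theorem norm_exp_jumpMatrix_mul_meanTransfer_le_one (y v : Fin d → ℝ) (e : ℝ) :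
    ‖NormedSpace.exp ((I * e) • jumpMatrix r y) * meanTransfer μ C r (-v) v‖ ≤ 1 := by
  rw [← exp_drift_smul_meanTransfer, norm_smul, mul_comm I, ← neg_mul, ← Complex.ofReal_neg,
    Complex.norm_exp_ofReal_mul_I, one_mul]
  exact l2_opNorm_meanTransfer_le_one μ hC hU r _ _

include hC hU hρ in
theorem norm_centredIntegrand_le [NeZero d] (y : Fin d → ℝ) (N : ℕ) (e : ℝ) (v : Fin d → ℝ) :
    ‖centredIntegrand μ C r ρ₀ y N e v‖ ≤ ∑ _τ : Coin d, ∑ T : Coin d × Coin d,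
      ‖projPsi d‖ * ∑' p : Lattice d × Lattice d, ‖kernel ρ₀ p.1 p.2 T.1 T.2‖ := by
  rw [centredIntegrand_eq]
  refine (norm_psiOne_dotProduct_mulVec_le _ _).trans ?_
  gcongr with τ _ T
  · exact norm_mul_pow_le _ (norm_exp_jumpMatrix_mul_meanTransfer_le_one μ hC hU y v e) N
  · exact norm_fourierVec_le hρ _ _ T

include hC hU hρ in
theorem exp_mul_charFn_eq_torusIntegral (y : Fin d → ℝ) (N : ℕ) (e : ℝ) :
    Complex.exp (-(I * N * (e * drift r y : ℝ))) * charFn μ C r ρ₀ N (e • y) =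
      torusIntegral (centredIntegrand μ C r ρ₀ y N e) := by
  rw [charFn_eq_torusIntegral μ hC hU r hρ, ← torusIntegral_const_mul]
  rfl

section Limit

variable (hsimple : ∀ v ∈ torusBox d,
    (meanTransfer μ C r (-v) v).charpoly.rootMultiplicity 1 = 1)
  {ι : Type*} {l : Filter ι} {e : ι → ℝ} (he : Tendsto e l (𝓝 0)) {N : ι → ℕ} {κ : ℝ}
  (hN : Tendsto (fun a => N a * e a ^ 2) l (𝓝 κ))

include hC hU hsimple he hN

theorem tendsto_projPsi_mul_pow [NeZero d] (y v : Fin d → ℝ) :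
    Tendsto (fun a => projPsi d * (NormedSpace.exp ((I * e a) • jumpMatrix r y) *
        meanTransfer μ C r (-v) v) ^ N a) l
      (𝓝 (Complex.exp (-κ * (1 / 2 * diffusionForm μ C r v y)) • projPsi d)) := by
  have hsecond : (1 / 2 * diffusionForm μ C r v y) • projPsi d =
      -((1 / 2 : ℂ) • (projPsi d * jumpMatrix r y ^ 2 * projPsi d)) -
        projPsi d * jumpMatrix r y * reducedResolventOne μ C r v * jumpMatrix r y * projPsi d := by
    rw [← neg_add', ← diffusionForm_smul_projPsi r y μ C v
      (reducedResolventOne_mul_projPsi μ hsimple hC hU v)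
      (projPsi_mul_reducedResolventOne μ hsimple hC hU v), ← neg_smul, neg_mul, neg_neg]
  have hscale : Tendsto (fun a => I * (e a : ℂ)) l (𝓝 0) := by
    simpa using ((Complex.continuous_ofReal.tendsto 0).comp he).const_mul I
  have hsteps : Tendsto (fun a => N a * (I * (e a : ℂ)) ^ 2) l (𝓝 (-κ)) := by
    refine ((Complex.continuous_ofReal.tendsto κ).comp hN).neg.congr fun a => ?_
    simp [mul_pow]
  exact tendsto_mul_pow_exp_mul (projPsi_mul_meanTransfer_neg μ hC hU r v)
    (meanTransfer_neg_mul_projPsi μ hC hU r v) projPsi_mul_self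
    (reducedResolventOne_mul_meanTransfer_sub_one μ hsimple hC hU v)
    (projPsi_mul_jumpMatrix_mul_projPsi r y) hsecond hscale
    (fun a => norm_exp_jumpMatrix_mul_meanTransfer_le_one μ hC hU y v (e a)) hsteps

include hρ

theorem tendsto_centredIntegrand [NeZero d] (y v : Fin d → ℝ) :
    Tendsto (fun a => centredIntegrand μ C r ρ₀ y (N a) (e a) v) l
      (𝓝 (limitIntegrand μ C r ρ₀ y κ v)) := by
  have hvec : Tendsto (fun a => fourierVec ρ₀ (e a • y + -v) v) l (𝓝 (fourierVec ρ₀ (-v) v)) := by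
    have hline : Continuous fun e : ℝ => e • y + -v := by fun_prop
    have h := (continuous_fourierVec hρ hline (continuous_const (y := v))).tendsto 0
    rw [zero_smul, zero_add] at h
    exact h.comp he
  have hlim : limitIntegrand μ C r ρ₀ y κ v = star (psiOne d) ⬝ᵥ
      ((Complex.exp (-κ * (1 / 2 * diffusionForm μ C r v y)) • projPsi d) *ᵥ
        fourierVec ρ₀ (-v) v) := by
    rw [limitIntegrand, Matrix.smul_mulVec, dotProduct_smul, Matrix.dotProduct_mulVec,
      psiOne_vecMul_projPsi, smul_eq_mul]
    ring_nf
  have hpair : Continuous fun q : PairMatrix d × (Coin d × Coin d → ℂ) =>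
      star (psiOne d) ⬝ᵥ (q.1 *ᵥ q.2) := by fun_prop
  have hpow := tendsto_projPsi_mul_pow μ hC hU hsimple he hN y v
  have h := (hpair.tendsto _).comp (hpow.prodMk_nhds hvec)
  rw [hlim]
  refine h.congr fun a => ?_
  rw [centredIntegrand_eq, Function.comp_apply]

variable [l.IsCountablyGenerated]

theorem tendsto_exp_mul_charFn (y : Fin d → ℝ) :
    Tendsto (fun a => Complex.exp (-(I * N a * (e a * drift r y : ℝ))) *
      charFn μ C r ρ₀ (N a) (e a • y)) l (𝓝 (torusIntegral (limitIntegrand μ C r ρ₀ y κ))) := by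
  have := neZero_of_rootMultiplicity_meanTransfer μ hsimple
  simp only [exp_mul_charFn_eq_torusIntegral μ hρ hC hU, torusIntegral]
  refine Tendsto.const_mul _ (tendsto_integral_filter_of_dominated_convergence _
    (Eventually.of_forall fun a => (continuous_centredIntegrand μ hρ y _ _).aestronglyMeasurable)
    (Eventually.of_forall fun a => ae_of_all _ (norm_centredIntegrand_le μ hρ hC hU y _ _))
    (integrable_const _) (ae_of_all _ fun v => ?_))
  exact tendsto_centredIntegrand μ hρ hC hU hsimple he hN y v

theorem integrableOn_limitIntegrand [l.NeBot] (y : Fin d → ℝ) :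
    IntegrableOn (limitIntegrand μ C r ρ₀ y κ) (torusBox d) := by
  have := neZero_of_rootMultiplicity_meanTransfer μ hsimple
  have hlim := tendsto_centredIntegrand μ hρ hC hU hsimple he hN y
  have hmeas := aestronglyMeasurable_of_tendsto_ae (μ := volume.restrict (torusBox d)) l
    (fun a => (continuous_centredIntegrand μ hρ y (N a) (e a)).aestronglyMeasurable)
    (ae_of_all _ hlim)
  exact Integrable.of_bound hmeas _ (ae_of_all _ fun v => le_of_tendsto (hlim v).norm
    (Eventually.of_forall fun a => norm_centredIntegrand_le μ hρ hC hU y (N a) (e a) v))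

end Limit

section Floor

theorem tendsto_inv_sqrt_natCast :
    Tendsto (fun n : ℕ => (Real.sqrt n)⁻¹) atTop (𝓝 0) :=
  tendsto_inv_atTop_zero.comp (Real.tendsto_sqrt_atTop.comp tendsto_natCast_atTop_atTop)

variable {t : ℝ} (ht : 0 ≤ t)

include ht

theorem tendsto_floor_mul_div : Tendsto (fun n : ℕ => (⌊t * n⌋₊ : ℝ) / n) atTop (𝓝 t) :=
  (tendsto_nat_floor_mul_div_atTop ht).comp tendsto_natCast_atTop_atTop

theorem tendsto_floor_mul_inv_sq :
    Tendsto (fun n : ℕ => (⌊t * n⌋₊ : ℝ) * (n : ℝ)⁻¹ ^ 2) atTop (𝓝 0) := by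
  have h := (tendsto_floor_mul_div ht).mul tendsto_inv_atTop_nhds_zero_nat
  rw [mul_zero] at h
  exact h.congr fun n => by ring

theorem tendsto_floor_mul_inv_sqrt_sq :
    Tendsto (fun n : ℕ => (⌊t * n⌋₊ : ℝ) * (Real.sqrt n)⁻¹ ^ 2) atTop (𝓝 t) := by
  refine (tendsto_floor_mul_div ht).congr fun n => ?_
  rw [inv_pow, Real.sq_sqrt n.cast_nonneg, div_eq_mul_inv]

theorem tendsto_exp_floor_mul (a : ℝ) :
    Tendsto (fun n : ℕ => Complex.exp (I * ⌊t * n⌋₊ * ((n : ℝ)⁻¹ * a : ℝ))) atTop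
      (𝓝 (Complex.exp (I * t * a))) := by
  refine (Complex.continuous_exp.tendsto _).comp ?_
  have hfloor := (Complex.continuous_ofReal.tendsto t).comp (tendsto_floor_mul_div ht)
  refine ((hfloor.const_mul I).mul_const (a : ℂ)).congr fun n => ?_
  simp only [Function.comp_apply]
  push_cast
  ring

end Floor

theorem fun_div_eq_inv_smul {ι : Type*} (y : ι → ℝ) (c : ℝ) : (fun j => y j / c) = c⁻¹ • y := by
  funext j
  rw [Pi.smul_apply, smul_eq_mul, div_eq_inv_mul]

section WalkLimits

variable (hsimple : ∀ v ∈ torusBox d,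
    (meanTransfer μ C r (-v) v).charpoly.rootMultiplicity 1 = 1)
  {t : ℝ} (ht : 0 ≤ t)

include hC hU hρ hsimple ht

theorem tendsto_charFn_ballistic (y : Fin d → ℝ) :
    Tendsto (fun n : ℕ => charFn μ C r ρ₀ ⌊t * n⌋₊ (fun j => y j / n)) atTop
      (𝓝 (Complex.exp (I * t * drift r y) * ∑' x, (kernel ρ₀ x x).trace)) := by
  have hcentred := tendsto_exp_mul_charFn μ hρ hC hU hsimple tendsto_inv_atTop_nhds_zero_nat
    (tendsto_floor_mul_inv_sq ht) y
  rw [torusIntegral_limitIntegrand_zero μ hρ] at hcentred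
  refine ((tendsto_exp_floor_mul ht (drift r y)).mul hcentred).congr fun n => ?_
  rw [fun_div_eq_inv_smul, ← mul_assoc, ← Complex.exp_add, add_neg_cancel, Complex.exp_zero,
    one_mul]

theorem tendsto_charFn_diffusive (y : Fin d → ℝ) :
    Tendsto (fun n : ℕ => Complex.exp (-(I * ⌊t * n⌋₊ * (drift r y / Real.sqrt n : ℝ))) *
        charFn μ C r ρ₀ ⌊t * n⌋₊ (fun j => y j / Real.sqrt n)) atTop
      (𝓝 (torusIntegral (limitIntegrand μ C r ρ₀ y t))) := by
  have hcentred := tendsto_exp_mul_charFn μ hρ hC hU hsimple tendsto_inv_sqrt_natCast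
    (tendsto_floor_mul_inv_sqrt_sq ht) y
  refine hcentred.congr fun n => ?_
  rw [fun_div_eq_inv_smul, div_eq_inv_mul]

end WalkLimits

end Scaling

end

end QuantumWalk

open QuantumWalk in
theorem mainTheorem2_general {d : ℕ} {Ω : Type*} [MeasurableSpace Ω] (μ : Measure Ω)
    [IsProbabilityMeasure μ] (C : Ω → CoinMatrix d)
    (hC_meas : ∀ σ τ, Measurable fun ω => C ω σ τ)
    (hC_unitary : ∀ ω, C ω ∈ Matrix.unitaryGroup (Coin d) ℂ)
    (r : Coin d → Lattice d)
    (hsimple : ∀ v ∈ torusBox d,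
      (meanTransfer μ C r (-v) v).charpoly.rootMultiplicity 1 = 1)
    (ρ₀ : WalkSpace d →L[ℂ] WalkSpace d)
    (hρ₀_summable : ∀ σ τ, Summable fun p : Lattice d × Lattice d =>
      ‖kernel ρ₀ p.1 p.2 σ τ‖) :
    (∀ v : Fin d → ℝ, Tendsto (reducedResolvent μ C r v) (𝓝[≠] (1 : ℂ))
      (𝓝 (reducedResolventOne μ C r v))) ∧
    (∀ v : Fin d → ℝ,
      HasSum (fun p : Lattice d × Lattice d =>
          phase v p.2 • kernel ρ₀ p.1 (p.1 + p.2))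
        (fourierKernel ρ₀ (-v) v)) ∧
    ∀ t : ℝ, 0 ≤ t → ∀ y : Fin d → ℝ,
      Tendsto (fun n : ℕ => charFn μ C r ρ₀ ⌊t * n⌋₊ (fun j => y j / n)) atTop
        (𝓝 (Complex.exp (I * t * drift r y) * ∑' x, (kernel ρ₀ x x).trace)) ∧
      IntegrableOn (fun v => Complex.exp (-(t / 2) * diffusionForm μ C r v y) *
        (fourierKernel ρ₀ (-v) v).trace) (torusBox d) ∧
      Tendsto (fun n : ℕ =>
          Complex.exp (-(I * (⌊t * n⌋₊ : ℂ) * ((drift r y / Real.sqrt n : ℝ) : ℂ))) *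
            charFn μ C r ρ₀ ⌊t * n⌋₊ (fun j => y j / Real.sqrt n)) atTop
        (𝓝 (torusIntegral fun v =>
          Complex.exp (-(t / 2) * diffusionForm μ C r v y) *
            (star (psiOne d) ⬝ᵥ fourierVec ρ₀ (-v) v))) ∧
      (torusIntegral fun v =>
          Complex.exp (-(t / 2) * diffusionForm μ C r v y) *
            (star (psiOne d) ⬝ᵥ fourierVec ρ₀ (-v) v)) =
        torusIntegral fun v =>
          Complex.exp (-(t / 2) * diffusionForm μ C r v y) *
            (fourierKernel ρ₀ (-v) v).trace := by
  have := neZero_of_rootMultiplicity_meanTransfer μ hsimple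
  refine ⟨tendsto_reducedResolvent μ hsimple hC_meas hC_unitary,
    hasSum_fourierKernel_neg hρ₀_summable, fun t ht y => ⟨?_, ?_, ?_, ?_⟩⟩
  · exact tendsto_charFn_ballistic μ hρ₀_summable hC_meas hC_unitary hsimple ht y
  · rw [← limitIntegrand_eq_trace]
    exact integrableOn_limitIntegrand μ hρ₀_summable hC_meas hC_unitary hsimple
      tendsto_inv_sqrt_natCast (tendsto_floor_mul_inv_sqrt_sq ht) y
  · exact tendsto_charFn_diffusive μ hρ₀_summable hC_meas hC_unitary hsimple ht y
  · exact congrArg torusIntegral (limitIntegrand_eq_trace μ y t)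

theorem mainTheorem2 {d : ℕ} {Ω : Type*} [MeasurableSpace Ω] (μ : Measure Ω)
    [IsProbabilityMeasure μ] (C : Ω → QuantumWalk.CoinMatrix d)
    (hC_meas : ∀ σ τ, Measurable fun ω => C ω σ τ)
    (hC_unitary : ∀ ω, C ω ∈ Matrix.unitaryGroup (QuantumWalk.Coin d) ℂ)
    (r : QuantumWalk.Coin d → QuantumWalk.Lattice d)
    (hS : QuantumWalk.AssumptionS μ C r)
    (ρ₀ : QuantumWalk.WalkSpace d →L[ℂ] QuantumWalk.WalkSpace d)
    (hρ₀ : QuantumWalk.IsDensityMatrix ρ₀)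
    (hρ₀_summable : ∀ σ τ, Summable fun p : QuantumWalk.Lattice d × QuantumWalk.Lattice d =>
      ‖QuantumWalk.kernel ρ₀ p.1 p.2 σ τ‖) :
    -- the limit defining `S_v(1)` exists
    (∀ v : Fin d → ℝ, Tendsto (QuantumWalk.reducedResolvent μ C r v) (𝓝[≠] (1 : ℂ))
      (𝓝 (QuantumWalk.reducedResolventOne μ C r v))) ∧
    -- the series for `R₀(-v,v)`
    (∀ v : Fin d → ℝ,
      HasSum (fun p : QuantumWalk.Lattice d × QuantumWalk.Lattice d =>
          QuantumWalk.phase v p.2 • QuantumWalk.kernel ρ₀ p.1 (p.1 + p.2))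
        (QuantumWalk.fourierKernel ρ₀ (-v) v)) ∧
    ∀ t : ℝ, 0 ≤ t → ∀ y : Fin d → ℝ,
      -- ballistic scaling
      Tendsto (fun n : ℕ => QuantumWalk.charFn μ C r ρ₀ ⌊t * n⌋₊ (fun j => y j / n)) atTop
        (𝓝 (Complex.exp (I * t * QuantumWalk.drift r y))) ∧
      -- diffusive scaling
      IntegrableOn (fun v => Complex.exp (-(t / 2) * QuantumWalk.diffusionForm μ C r v y) *
        (QuantumWalk.fourierKernel ρ₀ (-v) v).trace) (QuantumWalk.torusBox d) ∧
      Tendsto (fun n : ℕ =>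
          Complex.exp (-(I * (⌊t * n⌋₊ : ℂ) * ((QuantumWalk.drift r y / Real.sqrt n : ℝ) : ℂ))) *
            QuantumWalk.charFn μ C r ρ₀ ⌊t * n⌋₊ (fun j => y j / Real.sqrt n)) atTop
        (𝓝 (QuantumWalk.torusIntegral fun v =>
          Complex.exp (-(t / 2) * QuantumWalk.diffusionForm μ C r v y) *
            (star (QuantumWalk.psiOne d) ⬝ᵥ QuantumWalk.fourierVec ρ₀ (-v) v))) ∧
      (QuantumWalk.torusIntegral fun v =>
          Complex.exp (-(t / 2) * QuantumWalk.diffusionForm μ C r v y) *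
            (star (QuantumWalk.psiOne d) ⬝ᵥ QuantumWalk.fourierVec ρ₀ (-v) v)) =
        QuantumWalk.torusIntegral fun v =>
          Complex.exp (-(t / 2) * QuantumWalk.diffusionForm μ C r v y) *
            (QuantumWalk.fourierKernel ρ₀ (-v) v).trace := by
  simpa only [hρ₀.hasTrace_one.tsum_eq, mul_one] using
    mainTheorem2_general μ C hC_meas hC_unitary r (fun v hv => (hS v hv).2) ρ₀ hρ₀_summable
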